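/- **Setting.** For $v\in\mathbb C^k$ let $\|v\|_2$ be the Euclidean norm. Let $\{\mathcal I_b\}_{b=1}^B$ be a partition of a finite index set $I$. For $x\in\mathbb C^I$ let $x[b]$ be the subvector with indices in $\mathcal I_b$; $x$ is *group $S$-sparse* if at most $S$ of the $x[b]$ are nonzero, and $\|x\|_{2|\mathcal P}=\sum_b\|x[b]\|_2$. A matrix $\Phi$ has the *group restricted isometry property* (G-RIP) of order $S$ if for some $\delta\in(0,1)$ one has $(1-\delta)\|x\|_2^2\le\|\Phi x\|_2^2\le(1+\delta)\|x\|_2^2$ for all group $S$-sparse $x$; the smallest $\delta\ge 0$ for which this holds is its constant $\delta_{S|\mathcal P}$ (G-RIC). *System.* Let $N_T,N_R$ be the numbers of transmit and receive antennas, $\Theta=\{(r,s):1\le r\le N_R,\,1\le s\le N_T\}$, and let $K,L,Q\ge1$, $D\mid K$, $J\mid L$, $J$ even, $\Delta K=K/D$, $\Delta L=L/J$. The channel is $$H_{l,k}=\sum_{m=0}^{K-1}\sum_{i=-L/2}^{L/2-1}F_{m,i}\,e^{-2\pi \mathrm j(km/K-li/L)}\in\mathbb C^{N_R\times N_T},\qquad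 0\le l<L,\ 0\le k<K,$$ where $F_{m,i}\in\mathbb C^{N_R\times N_T}$ vanishes for $(m,i)\notin\{0,\dots,D-1\}\times\{-J/2,\dots,J/2-1\}$. Let $\{u_{m,i}\}$, indexed by these $JD$ pairs $(m,i)$, be an orthonormal basis of the functions on $\{0,\dots,J-1\}\times\{0,\dots,D-1\}$, and define $G_{m,i}\in\mathbb C^{N_R\times N_T}$ by $H_{\lambda\Delta L,\kappa\Delta K}=\sum_{m,i}G_{m,i}\,u_{m,i}[\lambda,\kappa]$. Write $G^{(\theta)}_{m,i}$ and $H^{(\theta)}_{l,k}$ for the entries with index $\theta=(r,s)$, and $G^{(\theta)}=(G^{(\theta)}_{m,i})_{(m,i)}$. Let $p^{(1)},\dots,p^{(N_T)}\in\mathbb C^{N_T}$ be linearly independent pilot vectors and $P=(p^{(1)}\cdots p^{(N_T)})$. Let $\mathcal P^{(1)},\dots,\mathcal P^{(N_T)}$ be pairwise disjoint sets of $Q$ pilot positions $\mu^{(s)}_q=(\lambda^{(s)}_q\Delta L,\kappa^{(s)}_q\Delta K)$, $1\le q\le Q$, in the subsampled grid. The received vectors are $y_{l,k}=H_{l,k}a_{l,k}+z_{l,k}$,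 where the transmitted vectors satisfy $a_\mu=p^{(s)}$ for all $\mu\in\mathcal P^{(s)}$. For $\theta=(r,s)$ put $y^{(\theta)}=([y_{\mu^{(s)}_q}]_r)_{q}$ and $z^{(\theta)}=([z_{\mu^{(s)}_q}]_r)_{q}$. Let $\Phi^{(s)}\in\mathbb C^{Q\times JD}$ have entries $\sqrt{JD/Q}\;u_{m,i}[\lambda^{(s)}_q,\kappa^{(s)}_q]$. *Estimator.* Fix a partition $\mathcal P=\{\mathcal I_b\}_{b=1}^B$ of the set of the $JD$ index pairs $(m,i)$. Let $y$ be the stack of the $y^{(\theta)}$, $\theta\in\Theta$; let $\Phi$ be the block-diagonal matrix whose block for $\theta=(r,s)$ is $\Phi^{(s)}$; and let $\tilde{\mathcal P}=\{\mathcal I_b\times\Theta\}_{b=1}^B$ be the stacked partition. Obtain $\hat x=(\hat x^{(\theta)})_\theta$ from $(y,\Phi,\tilde{\mathcal P})$ by one of the following methods (this is *MGCS mode*). * *G-BPDN* (given $\epsilon>0$): $\hat x$ minimizes $\|x'\|_{2|\tilde{\mathcal P}}$ subject to $\|\Phi x'-y\|_2\le\epsilon$. * *G-CoSaMP* with $n$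 iterations (given $S\ge 1$): start with $\hat x_0=0$. In each iteration, let $\Omega$ be the set of groups on which a best group $2S$-sparse approximation (in $\|\cdot\|_2$) of $\Phi^H(y-\Phi\hat x_{j-1})$ is nonzero; let $T$ be the union of $\Omega$ with the set of groups on which $\hat x_{j-1}$ is nonzero; let $b$ minimize $\|y-\Phi b\|_2$ among vectors vanishing outside the groups in $T$; let $\hat x_j$ be a best group $S$-sparse approximation of $b$ in $\|\cdot\|_2$. Ties are broken arbitrarily, and $\hat x=\hat x_n$. Then put $\hat{\tilde G}^{(\theta)}_{m,i}=\sqrt{JD/Q}\;\hat x^{(\theta)}_{m,i}$; let the $r$th row of $\hat G_{m,i}$ be the transpose of $P^{-T}\big(\hat{\tilde G}^{(r,1)}_{m,i},\dots,\hat{\tilde G}^{(r,N_T)}_{m,i}\big)^T$; put $\hat H_{\lambda\Delta L,\kappa\Delta K}=\sum_{m,i}\hat G_{m,i}u_{m,i}[\lambda,\kappa]$; let $\hat F_{m,i}=\frac1{JD}\sum_{\lambda=0}^{J-1}\sum_{\kappa=0}^{D-1}\hat H_{\lambda\Delta L,\kappa\Delta K}\,e^{-2\pi \mathrm j(i\lambda/J-m\kappa/D)}$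 for $0\le m<D$, $-J/2\le i<J/2$, and $\hat F_{m,i}=0$ otherwise; and obtain the channel estimate $\hat H_{l,k}$ from $\hat F_{m,i}$ in the same way as $H_{l,k}$ from $F_{m,i}$. The estimation error is $$E=\sqrt{\sum_{\theta\in\Theta}\sum_{l=0}^{L-1}\sum_{k=0}^{K-1}\big|\hat H^{(\theta)}_{l,k}-H^{(\theta)}_{l,k}\big|^2}.$$ For $\mathcal S\subseteq\{1,\dots,B\}$ with $|\mathcal S|=S\ge1$ let $C_{G,\mathcal S,\mathcal P}=\sum_{b\notin\mathcal S}\sqrt{\sum_{\theta\in\Theta}\|G^{(\theta)}[b]\|_2^2}$, and let $C_P=\|P\|\,\|P^{-1}\|$ with the spectral norm $\|\cdot\|$. **Theorem.** Let $\epsilon>0$ and assume $\sqrt{\sum_{\theta\in\Theta}\|z^{(\theta)}\|_2^2}\le\epsilon$. 1. Suppose $\hat x$ is a solution of G-BPDN in MGCS mode. If every $\Phi^{(s)}$ has the G-RIP of order $2S$ with respect to $\mathcal P$ with G-RIC $\delta^{(s)}_{2S|\mathcal P}<\sqrt2-1$, then $$E\le C_0'\,\frac{C_{G,\mathcal S,\mathcal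 P}}{\sqrt S}+C_1'\,\epsilon,\qquad C_0'=c_0\sqrt{\tfrac{KL}{JD}}\,C_P,\quad C_1'=c_1\sqrt{\tfrac{KL}{Q}}\,\|P^{-1}\|,$$ where $c_0=\frac{2(1-\delta)}{1-(1+\sqrt2)\delta}$, $c_1=\frac{4\sqrt{1+\delta}}{1-(1+\sqrt2)\delta}$, and $\delta$ is the G-RIC of order $2S$ of $\Phi$ with respect to $\tilde{\mathcal P}$. 2. Suppose $\hat x$ is the result of $n\ge0$ iterations of G-CoSaMP in MGCS mode. If every $\Phi^{(s)}$ has the G-RIP of order $4S$ with respect to $\mathcal P$ with G-RIC $\delta^{(s)}_{4S|\mathcal P}\le0.1$, then $$E\le C_0''\Big(1+\frac1{\sqrt S}\Big)C_{G,\mathcal S,\mathcal P}+C_1''\,\epsilon+C_2''(n),$$ where $C_0''=20\sqrt{\tfrac{KL}{JD}}\,C_P$, $C_1''=20\sqrt{\tfrac{KL}{Q}}\,\|P^{-1}\|$ and $C_2''(n)=\frac1{2^n}\,C_P\sqrt{\frac{KL}{JD}\sum_{\theta\in\Theta}\sum_{m=0}^{D-1}\sum_{i=-J/2}^{J/2-1}\big|G^{(\theta)}_{m,i}\big|^2}$.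 -/

import Mathlib

open scoped Matrix

noncomputable section

namespace MGCS

/-! ## Group-sparse compressed sensing over `ℂ` -/

/-- The Euclidean norm of a finitely indexed complex vector. -/
def l2norm {ι : Type*} [Fintype ι] (v : ι → ℂ) : ℝ :=
  ‖(WithLp.toLp 2 v : EuclideanSpace ℂ ι)‖

section Groups

variable {ι ρ β : Type*} [Fintype ι] [Fintype ρ] [Fintype β] [DecidableEq β]

/-- A partition `{I_b}` of the index set `ι` is encoded by the map `g` that sends an index `j` to
the label `b` of the group that contains it, so `I_b = {j | g j = b}`. This is the subvector
`x[b]` of `x` made of the entries with index in `I_b`. -/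
def subvec (g : ι → β) (x : ι → ℂ) (b : β) : {j // g j = b} → ℂ := fun j => x j

/-- The set of groups on which `x` is not identically zero. -/
def groupSupp (g : ι → β) (x : ι → ℂ) : Set β := {b | subvec g x b ≠ 0}

/-- `x` is group `S`-sparse: at most `S` of its subvectors are not identically zero. -/
def GroupSparse (g : ι → β) (S : ℕ) (x : ι → ℂ) : Prop := (groupSupp g x).ncard ≤ S

/-- The mixed norm: the sum over the groups of the Euclidean norms of the subvectors. -/
def mixedNorm (g : ι → β) (x : ι → ℂ) : ℝ := ∑ b, l2norm (subvec g x b)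

/-- The double inequality of the group restricted isometry property of order `S`. -/
def GRIPWith (g : ι → β) (S : ℕ) (Φ : Matrix ρ ι ℂ) (δ : ℝ) : Prop :=
  ∀ x : ι → ℂ, GroupSparse g S x →
    (1 - δ) * l2norm x ^ 2 ≤ l2norm (Φ *ᵥ x) ^ 2 ∧
      l2norm (Φ *ᵥ x) ^ 2 ≤ (1 + δ) * l2norm x ^ 2

/-- The group restricted isometry property of order `S`. -/
def HasGRIP (g : ι → β) (S : ℕ) (Φ : Matrix ρ ι ℂ) : Prop :=
  ∃ δ : ℝ, 0 < δ ∧ δ < 1 ∧ GRIPWith g S Φ δ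

/-- The group restricted isometry constant of order `S`: the smallest `δ ≥ 0` for which the double
inequality holds. -/
def gRIC (g : ι → β) (S : ℕ) (Φ : Matrix ρ ι ℂ) : ℝ :=
  sInf {δ : ℝ | 0 ≤ δ ∧ GRIPWith g S Φ δ}

/-- `xh` solves the group basis pursuit denoising program: minimize the mixed norm of `x'` subject
to `‖Φ x' - y‖ ≤ ε`. -/
def IsGBPDNSolution (g : ι → β) (Φ : Matrix ρ ι ℂ) (y : ρ → ℂ) (ε : ℝ) (xh : ι → ℂ) : Prop :=
  l2norm (Φ *ᵥ xh - y) ≤ ε ∧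
    ∀ x' : ι → ℂ, l2norm (Φ *ᵥ x' - y) ≤ ε → mixedNorm g xh ≤ mixedNorm g x'

/-- `w` is a best group `S`-sparse approximation of `v` in the Euclidean norm; equivalently, it
keeps `S` groups of `v` with largest Euclidean norm (ties broken arbitrarily) and sets the other
groups to zero. -/
def IsBestGroupApprox (g : ι → β) (S : ℕ) (v w : ι → ℂ) : Prop :=
  GroupSparse g S w ∧ ∀ w' : ι → ℂ, GroupSparse g S w' → l2norm (v - w) ≤ l2norm (v - w')

/-- `b` is a least-squares solution of `Φ b = y` among the vectors vanishing outside the groups in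
`T`. It is unique, equal to the pseudoinverse solution, as soon as the corresponding columns
of `Φ` are linearly independent. -/
def IsGroupLeastSquares (g : ι → β) (Φ : Matrix ρ ι ℂ) (y : ρ → ℂ) (T : Set β)
    (b : ι → ℂ) : Prop :=
  groupSupp g b ⊆ T ∧
    ∀ b' : ι → ℂ, groupSupp g b' ⊆ T → l2norm (y - Φ *ᵥ b) ≤ l2norm (y - Φ *ᵥ b')

/-- One iteration of group CoSaMP (model-based CoSaMP for the group sparsity model), from the
estimate `x` to the estimate `x'`: form the proxy `Φᴴ (y - Φ x)`, find the groups `Ω` supporting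
its best group `2S`-sparse approximation, merge `Ω` with the group support of `x`, solve the
least-squares problem on the merged groups, and prune the result to `S` groups. -/
def IsGCoSaMPStep (g : ι → β) (S : ℕ) (Φ : Matrix ρ ι ℂ) (y : ρ → ℂ) (x x' : ι → ℂ) : Prop :=
  ∃ w b : ι → ℂ,
    IsBestGroupApprox g (2 * S) (Φᴴ *ᵥ (y - Φ *ᵥ x)) w ∧
    IsGroupLeastSquares g Φ y (groupSupp g w ∪ groupSupp g x) b ∧
    IsBestGroupApprox g S b x'

/-- `IsGCoSaMPIterate g S Φ y n x`: group CoSaMP, started at zero, can have the estimate `x` after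
`n` iterations (the only freedom is in the breaking of ties). -/
inductive IsGCoSaMPIterate (g : ι → β) (S : ℕ) (Φ : Matrix ρ ι ℂ) (y : ρ → ℂ) :
    ℕ → (ι → ℂ) → Prop
  | zero : IsGCoSaMPIterate g S Φ y 0 0
  | succ {n : ℕ} {x x' : ι → ℂ} : IsGCoSaMPIterate g S Φ y n x → IsGCoSaMPStep g S Φ y x x' →
      IsGCoSaMPIterate g S Φ y (n + 1) x'

end Groups

/-- The spectral norm of a square matrix. -/
def specNorm {n : ℕ} (A : Matrix (Fin n) (Fin n) ℂ) : ℝ :=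
  ‖Matrix.toEuclideanCLM (𝕜 := ℂ) A‖

/-- First error constant of group basis pursuit denoising, for the isometry constant `δ`. -/
def c0 (δ : ℝ) : ℝ := 2 * (1 - δ) / (1 - (1 + √2) * δ)

/-- Second error constant of group basis pursuit denoising, for the isometry constant `δ`. -/
def c1 (δ : ℝ) : ℝ := 4 * √(1 + δ) / (1 - (1 + √2) * δ)

/-! ## The multicarrier MIMO system and the channel estimator -/

/-- The fixed design parameters: `NT` transmit and `NR` receive antennas, `K` subcarriers,
`L` symbols, a `D × J` delay-Doppler support region, `Q` pilot positions per transmit antenna;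
an orthonormal basis `u_{m,i}[lam, kap]` of functions on the subsampled time-frequency grid;
linearly independent pilot vectors `p^(s)`; and pairwise disjoint pilot position sets.

A pair `(m, i)` in `Fin D × Fin J` stands for the delay `m` and the Doppler shift `i - J/2`; a pair
`(lam, kap)` in `Fin J × Fin D` stands for the grid point `(lam * (L/J), kap * (K/D))`. -/
structure MIMOSystem where
  NT : ℕ
  NR : ℕ
  K : ℕ
  L : ℕ
  D : ℕ
  J : ℕ
  Q : ℕ
  K_pos : 0 < K
  L_pos : 0 < L
  Q_pos : 0 < Q
  D_dvd_K : D ∣ K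
  J_dvd_L : J ∣ L
  J_even : Even J
  /-- the orthonormal basis `u` -/
  u : OrthonormalBasis (Fin D × Fin J) ℂ (EuclideanSpace ℂ (Fin J × Fin D))
  /-- the pilot vectors: `p s t` is the `t`-th entry of `p^(s)` -/
  p : Fin NT → Fin NT → ℂ
  p_indep : LinearIndependent ℂ p
  /-- `pos s q` is the `q`-th pilot position `(lam, kap)` of the `s`-th pilot set -/
  pos : Fin NT → Fin Q → Fin J × Fin D
  /-- the positions within a set are distinct, and the sets are pairwise disjoint -/
  pos_injective : Function.Injective fun sq : Fin NT × Fin Q => pos sq.1 sq.2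

namespace MIMOSystem

variable (sys : MIMOSystem)

/-- `NR × NT` complex matrices. -/
abbrev Mat : Type := Matrix (Fin sys.NR) (Fin sys.NT) ℂ

/-- The set of channel indices `θ = (r, s)`. -/
abbrev Chan : Type := Fin sys.NR × Fin sys.NT

/-- The index set of the delay-Doppler coefficients. -/
abbrev DD : Type := Fin sys.D × Fin sys.J

/-- The integers `-n/2, …, n/2 - 1` (for even `n`). -/
def dopplerRange (n : ℕ) : Finset ℤ := Finset.Ico (-((n / 2 : ℕ) : ℤ)) ((n / 2 : ℕ) : ℤ)

/-- The two-dimensional DFT expansion giving the channel coefficient matrix at the time-frequency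
position `(l, k)` from delay-Doppler coefficients `F m i`. -/
def channel (F : ℕ → ℤ → sys.Mat) (l k : ℕ) : sys.Mat :=
  ∑ m ∈ Finset.range sys.K, ∑ i ∈ dopplerRange sys.L,
    Complex.exp (-2 * Real.pi * Complex.I *
      ((k : ℂ) * (m : ℂ) / (sys.K : ℂ) - (l : ℂ) * (i : ℂ) / (sys.L : ℂ))) • F m i

/-- Within the fundamental region, `F` vanishes outside
`{0, …, D - 1} × {-J/2, …, J/2 - 1}`. -/
def SupportedInRegion (F : ℕ → ℤ → sys.Mat) : Prop :=
  ∀ m < sys.K, ∀ i ∈ dopplerRange sys.L, F m i ≠ 0 → m < sys.D ∧ i ∈ dopplerRange sys.J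

/-- The symbol time of a subsampled grid point. -/
def gridTime (μ : Fin sys.J × Fin sys.D) : ℕ := μ.1 * (sys.L / sys.J)

/-- The subcarrier of a subsampled grid point. -/
def gridFreq (μ : Fin sys.J × Fin sys.D) : ℕ := μ.2 * (sys.K / sys.D)

/-- The coefficient matrices `G_{m,i}` of the subsampled channel in the orthonormal basis `u`. -/
def coeff (F : ℕ → ℤ → sys.Mat) (c : sys.DD) : sys.Mat :=
  Matrix.of fun r s =>
    sys.u.repr (WithLp.toLp 2 fun μ => sys.channel F (sys.gridTime μ) (sys.gridFreq μ) r s) c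

/-- The pilot matrix `P`, whose columns are the pilot vectors. -/
def pilotMatrix : Matrix (Fin sys.NT) (Fin sys.NT) ℂ := Matrix.of fun t s => sys.p s t

/-- The measurement matrix `Φ^(s)`: the rows of the unitary matrix with columns `u_{m,i}` that
belong to the `s`-th pilot set, scaled by `√(JD/Q)`. -/
def Phi (s : Fin sys.NT) : Matrix (Fin sys.Q) sys.DD ℂ :=
  Matrix.of fun q c => (√((sys.J * sys.D : ℝ) / sys.Q) : ℂ) * sys.u c (sys.pos s q)

/-- The stacked block-diagonal measurement matrix with blocks `Φ^(s)`, `θ = (r, s)`. -/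
def PhiStack : Matrix (Fin sys.Q × sys.Chan) (sys.DD × sys.Chan) ℂ :=
  Matrix.blockDiagonal fun θ : sys.Chan => sys.Phi θ.2

/-- The stacked partition: the `b`-th group collects the indices of the `b`-th group of `g` for
all channels. -/
def stackPartition {β : Type*} (g : sys.DD → β) : sys.DD × sys.Chan → β := fun jθ => g jθ.1

/-- The demodulated symbols `y_{l,k} = H_{l,k} a_{l,k} + z_{l,k}`. -/
def received (F : ℕ → ℤ → sys.Mat) (a : ℕ → ℕ → Fin sys.NT → ℂ) (z : ℕ → ℕ → Fin sys.NR → ℂ)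
    (l k : ℕ) : Fin sys.NR → ℂ :=
  sys.channel F l k *ᵥ a l k + z l k

/-- The vector of the values at receive antenna `r` and at the pilot positions of the `s`-th pilot
set, for `θ = (r, s)`. -/
def atPilots (v : ℕ → ℕ → Fin sys.NR → ℂ) (θ : sys.Chan) : Fin sys.Q → ℂ :=
  fun q => v (sys.gridTime (sys.pos θ.2 q)) (sys.gridFreq (sys.pos θ.2 q)) θ.1

/-- The stack over all channels of the vectors `atPilots v θ`. -/
def stackPilots (v : ℕ → ℕ → Fin sys.NR → ℂ) : Fin sys.Q × sys.Chan → ℂ :=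
  fun qθ => sys.atPilots v qθ.2 qθ.1

/-- The pilot vector `p^(s)` is transmitted at all positions of the `s`-th pilot set. -/
def TransmitsPilots (a : ℕ → ℕ → Fin sys.NT → ℂ) : Prop :=
  ∀ s q, a (sys.gridTime (sys.pos s q)) (sys.gridFreq (sys.pos s q)) = sys.p s

/-- Rescaling of the stacked compressed sensing estimate `xh`. -/
def GtildeHat (xh : sys.DD × sys.Chan → ℂ) (c : sys.DD) : sys.Mat :=
  Matrix.of fun r s => (√((sys.J * sys.D : ℝ) / sys.Q) : ℂ) * xh (c, (r, s))

/-- Estimates of the coefficient matrices: the `r`-th row is `P^{-T}` applied to the `r`-th row of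
`GtildeHat`. -/
def GHat (xh : sys.DD × sys.Chan → ℂ) (c : sys.DD) : sys.Mat :=
  Matrix.of fun r => (sys.pilotMatrixᵀ)⁻¹ *ᵥ sys.GtildeHat xh c r

/-- Estimates of the subsampled channel coefficient matrices. -/
def HSubHat (xh : sys.DD × sys.Chan → ℂ) (μ : Fin sys.J × Fin sys.D) : sys.Mat :=
  ∑ c : sys.DD, sys.u c μ • sys.GHat xh c

/-- Estimates of the delay-Doppler coefficients, by the inverse two-dimensional DFT. -/
def FHat (xh : sys.DD × sys.Chan → ℂ) (m : ℕ) (i : ℤ) : sys.Mat :=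
  if m < sys.D ∧ i ∈ dopplerRange sys.J then
    (1 / ((sys.J : ℂ) * (sys.D : ℂ))) • ∑ lam : Fin sys.J, ∑ kap : Fin sys.D,
      Complex.exp (-2 * Real.pi * Complex.I *
        ((i : ℂ) * ((lam : ℕ) : ℂ) / (sys.J : ℂ) - (m : ℂ) * ((kap : ℕ) : ℂ) / (sys.D : ℂ))) •
        sys.HSubHat xh (lam, kap)
  else 0

/-- The estimates of all channel coefficient matrices. -/
def HHat (xh : sys.DD × sys.Chan → ℂ) (l k : ℕ) : sys.Mat := sys.channel (sys.FHat xh) l k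

/-- The estimation error `E` (root of the sum of squared errors over all channels and positions)
of the estimator that obtains `xh` from compressed sensing. -/
def rmse (F : ℕ → ℤ → sys.Mat) (xh : sys.DD × sys.Chan → ℂ) : ℝ :=
  √(∑ θ : sys.Chan, ∑ l ∈ Finset.range sys.L, ∑ k ∈ Finset.range sys.K,
    ‖sys.HHat xh l k θ.1 θ.2 - sys.channel F l k θ.1 θ.2‖ ^ 2)

/-- The leakage of the coefficients `G_{m,i}` outside the groups with label in `A`. -/
def leakage {β : Type*} [Fintype β] [DecidableEq β] (g : sys.DD → β) (A : Finset β)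
    (F : ℕ → ℤ → sys.Mat) : ℝ :=
  ∑ b ∈ Aᶜ, √(∑ θ : sys.Chan, l2norm (subvec g (fun c => sys.coeff F c θ.1 θ.2) b) ^ 2)

/-- `C_P = ‖P‖ ‖P⁻¹‖`. -/
def CP : ℝ := specNorm sys.pilotMatrix * specNorm sys.pilotMatrix⁻¹

end MIMOSystem

end MGCS

end

/-! Pilot observation turns the received values into noisy measurements, by the block-diagonal
matrix with blocks `Φ⁽ˢ⁾`, of the rescaled entries of `G̃ = G P`; that matrix inherits the group
restricted isometry constants of its blocks. Restriction to the groups enters the recovery bounds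
only through a family of mutually orthogonal projections of a real inner product space. For basis
pursuit, the error lies in a cone off the `S` given groups, and cutting its tail into shells of
`S` blocks of decreasing norm controls it through the restricted isometry property. For CoSaMP,
each iteration halves the distance to a group sparse vector up to the noise, into which the part
of the signal off the `S` given groups is absorbed. The recovery error is transferred to the
channel by Parseval's identity, once on the full grid and once on the subsampled grid, which costs
the factor `KL/(JD)`, and by the spectral norms of `P` and `P⁻¹`, which act on the rows of the
coefficient matrices. -/

noncomputable section

namespace MGCS

open Finset
open scoped InnerProductSpace

lemma le_of_mul_sq_le_mul {a b c : ℝ} (ha : 0 ≤ a) (hb : 0 ≤ b) (h : c * a ^ 2 ≤ a * b) :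
    c * a ≤ b := by
  rcases ha.eq_or_lt with rfl | ha
  · simpa using hb
  · exact le_of_mul_le_mul_left (by linarith) ha

/-! ### Block decompositions of an inner product space -/

section BlockDecomposition

variable {β E : Type*} [NormedAddCommGroup E] [InnerProductSpace ℝ E]

/-- `P` is the family of orthogonal projections onto mutually orthogonal blocks spanning `E`. For
the partition of an index set, `P b` restricts a vector to the group with label `b`. -/
structure IsBlockDecomposition [Fintype β] (P : β → E →ₗ[ℝ] E) : Prop
    extends CompleteOrthogonalIdempotents P where
  isSymmetric (b : β) : (P b).IsSymmetric

/-- The projection onto the span of the blocks with label in `V`. -/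
def blockProj (P : β → E →ₗ[ℝ] E) (V : Finset β) : E →ₗ[ℝ] E := ∑ b ∈ V, P b

/-- The span of the blocks with label in `V`: the vectors whose block support lies in `V`. -/
def blockSpan (P : β → E →ₗ[ℝ] E) (V : Finset β) : Submodule ℝ E :=
  LinearMap.range (blockProj P V)

variable {P : β → E →ₗ[ℝ] E} {V W : Finset β} {x y : E}

lemma blockProj_apply (V : Finset β) (x : E) : blockProj P V x = ∑ b ∈ V, P b x := by
  simp [blockProj]

lemma blockProj_singleton (b : β) (x : E) : blockProj P {b} x = P b x := by
  rw [blockProj_apply, sum_singleton]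

lemma blockProj_mem_blockSpan (V : Finset β) (x : E) : blockProj P V x ∈ blockSpan P V :=
  ⟨x, rfl⟩

lemma blockProj_union [DecidableEq β] (h : Disjoint V W) (x : E) :
    blockProj P (V ∪ W) x = blockProj P V x + blockProj P W x := by
  simp only [blockProj_apply, sum_union h]

namespace IsBlockDecomposition

variable [Fintype β] (hP : IsBlockDecomposition P)
include hP

lemma isSymmetric_blockProj (V : Finset β) : (blockProj P V).IsSymmetric :=
  LinearMap.isSymmetric_sum V fun b _ => hP.isSymmetric b

lemma blockProj_blockProj [DecidableEq β] (V W : Finset β) (x : E) :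
    blockProj P V (blockProj P W x) = blockProj P (V ∩ W) x := by
  have h : blockProj P V * blockProj P W = blockProj P (V ∩ W) := by
    simp only [blockProj, sum_mul_sum, hP.mul_eq, sum_ite_eq, ← sum_filter, filter_mem_eq_inter]
  exact LinearMap.congr_fun h x

lemma mem_blockSpan_iff : x ∈ blockSpan P V ↔ blockProj P V x = x := by
  classical
  refine ⟨?_, fun h => ⟨x, h⟩⟩
  rintro ⟨y, rfl⟩
  rw [hP.blockProj_blockProj, inter_self]

lemma blockSpan_mono (h : V ⊆ W) : blockSpan P V ≤ blockSpan P W := by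
  classical
  rintro _ ⟨y, rfl⟩
  exact hP.mem_blockSpan_iff.2 (by rw [hP.blockProj_blockProj, inter_eq_right.2 h])

lemma blockProj_eq_zero_of_disjoint (h : Disjoint V W) (hx : x ∈ blockSpan P W) :
    blockProj P V x = 0 := by
  classical
  rw [← hP.mem_blockSpan_iff.1 hx, hP.blockProj_blockProj, disjoint_iff_inter_eq_empty.1 h,
    blockProj_apply, sum_empty]

lemma inner_eq_zero_of_disjoint (h : Disjoint V W) (hx : x ∈ blockSpan P V)
    (hy : y ∈ blockSpan P W) : ⟪x, y⟫_ℝ = 0 := by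
  rw [← hP.mem_blockSpan_iff.1 hx, hP.isSymmetric_blockProj,
    hP.blockProj_eq_zero_of_disjoint h hy, inner_zero_right]

lemma inner_blockProj_self (V : Finset β) (x : E) :
    ⟪x, blockProj P V x⟫_ℝ = ‖blockProj P V x‖ ^ 2 := by
  classical
  rw [← real_inner_self_eq_norm_sq, hP.isSymmetric_blockProj V x, hP.blockProj_blockProj,
    inter_self]

lemma norm_sq_blockProj (V : Finset β) (x : E) :
    ‖blockProj P V x‖ ^ 2 = ∑ b ∈ V, ‖P b x‖ ^ 2 := by
  rw [← hP.inner_blockProj_self, blockProj_apply, inner_sum]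
  exact sum_congr rfl fun b _ => by
    rw [← blockProj_singleton b, hP.inner_blockProj_self, blockProj_singleton]

lemma norm_blockProj_mono (h : V ⊆ W) (x : E) : ‖blockProj P V x‖ ≤ ‖blockProj P W x‖ := by
  refine le_of_sq_le_sq ?_ (norm_nonneg _)
  rw [hP.norm_sq_blockProj, hP.norm_sq_blockProj]
  exact sum_le_sum_of_subset_of_nonneg h fun _ _ _ => sq_nonneg _

lemma norm_blockProj_le (V : Finset β) (x : E) : ‖blockProj P V x‖ ≤ ‖x‖ :=
  (hP.norm_blockProj_mono (subset_univ V) x).trans_eq (by rw [blockProj, hP.complete]; rfl)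

lemma sum_norm_le_sqrt_card_mul (V : Finset β) (x : E) :
    ∑ b ∈ V, ‖P b x‖ ≤ √(#V) * ‖blockProj P V x‖ := by
  refine le_of_sq_le_sq ?_ (by positivity)
  rw [mul_pow, Real.sq_sqrt (by positivity), hP.norm_sq_blockProj]
  exact sq_sum_le_card_mul_sum_sq

variable [DecidableEq β]

lemma norm_sq_blockProj_union (h : Disjoint V W) (x : E) :
    ‖blockProj P (V ∪ W) x‖ ^ 2 = ‖blockProj P V x‖ ^ 2 + ‖blockProj P W x‖ ^ 2 := by
  simp only [hP.norm_sq_blockProj, sum_union h]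

lemma blockProj_add_compl (V : Finset β) (x : E) : blockProj P V x + blockProj P Vᶜ x = x := by
  rw [← blockProj_union disjoint_compl_right, union_compl]
  exact LinearMap.congr_fun hP.complete x

lemma norm_le_add_compl (V : Finset β) (x : E) :
    ‖x‖ ≤ ‖blockProj P V x‖ + ‖blockProj P Vᶜ x‖ := by
  simpa only [hP.blockProj_add_compl] using norm_add_le (blockProj P V x) (blockProj P Vᶜ x)

end IsBlockDecomposition

end BlockDecomposition

/-! ### The restricted isometry property with respect to blocks -/

section BlockRIP

variable {β E F : Type*} [NormedAddCommGroup E] [InnerProductSpace ℝ E]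
  [NormedAddCommGroup F] [InnerProductSpace ℝ F]

/-- The restricted isometry inequality of order `n` with constant `δ`: on vectors supported on at
most `n` blocks, `f` changes the squared norm by a factor between `1 - δ` and `1 + δ`. -/
def BlockRIP (P : β → E →ₗ[ℝ] E) (f : E →ₗ[ℝ] F) (n : ℕ) (δ : ℝ) : Prop :=
  ∀ V : Finset β, #V ≤ n → ∀ x ∈ blockSpan P V,
    (1 - δ) * ‖x‖ ^ 2 ≤ ‖f x‖ ^ 2 ∧ ‖f x‖ ^ 2 ≤ (1 + δ) * ‖x‖ ^ 2

namespace BlockRIP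

variable {P : β → E →ₗ[ℝ] E} {f : E →ₗ[ℝ] F} {n : ℕ} {δ : ℝ} {V W : Finset β} {u v x : E}
  (hf : BlockRIP P f n δ)
include hf

lemma norm_map_le (hV : #V ≤ n) (hx : x ∈ blockSpan P V) : ‖f x‖ ≤ √(1 + δ) * ‖x‖ := by
  rw [← Real.sqrt_sq (norm_nonneg x), ← Real.sqrt_mul' _ (sq_nonneg _)]
  exact Real.le_sqrt_of_sq_le (hf V hV x hx).2

lemma abs_inner_map_le_half_mul_add [Fintype β] (hP : IsBlockDecomposition P) (hd : Disjoint V W)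
    (hn : #V + #W ≤ n) (hu : u ∈ blockSpan P V) (hv : v ∈ blockSpan P W) :
    |⟪f u, f v⟫_ℝ| ≤ δ / 2 * (‖u‖ ^ 2 + ‖v‖ ^ 2) := by
  classical
  have hcard : #(V ∪ W) ≤ n := (card_union_le V W).trans hn
  have hu' := hP.blockSpan_mono (subset_union_left (s₂ := W)) hu
  have hv' := hP.blockSpan_mono (subset_union_right (s₁ := V)) hv
  have hadd := hf _ hcard _ (add_mem hu' hv')
  have hsub := hf _ hcard _ (sub_mem hu' hv')
  simp only [map_add, map_sub, norm_add_sq_real, norm_sub_sq_real,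
    hP.inner_eq_zero_of_disjoint hd hu hv] at hadd hsub
  rw [abs_le]
  constructor <;> linarith

/-- Rescaling `u` and `v` to equal norms turns the additive bound into a multiplicative one. -/
lemma abs_inner_map_le [Fintype β] (hP : IsBlockDecomposition P) (hd : Disjoint V W)
    (hn : #V + #W ≤ n) (hu : u ∈ blockSpan P V) (hv : v ∈ blockSpan P W) :
    |⟪f u, f v⟫_ℝ| ≤ δ * ‖u‖ * ‖v‖ := by
  rcases eq_or_ne u 0 with rfl | hu0
  · simp
  rcases eq_or_ne v 0 with rfl | hv0
  · simp
  have hpos : 0 < ‖u‖ * ‖v‖ := mul_pos (norm_pos_iff.2 hu0) (norm_pos_iff.2 hv0)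
  have h := hf.abs_inner_map_le_half_mul_add hP hd hn
    (Submodule.smul_mem _ ‖v‖ hu) (Submodule.smul_mem _ ‖u‖ hv)
  simp only [map_smul, real_inner_smul_left, real_inner_smul_right, norm_smul, norm_norm, abs_mul,
    abs_norm] at h
  refine le_of_mul_le_mul_left ?_ hpos
  linarith

end BlockRIP

end BlockRIP

/-! ### Shelling by the largest blocks -/

section Shelling

lemma exists_subset_card_mul_le_sum {β : Type*} [DecidableEq β] (a : β → ℝ) (U : Finset β) {S : ℕ}
    (hS : 0 < S) :
    ∃ T ⊆ U, #T ≤ S ∧ (U.Nonempty → T.Nonempty) ∧ ∀ b ∈ U \ T, S * a b ≤ ∑ c ∈ T, a c := by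
  rcases le_total #U S with hU | hU
  · exact ⟨U, subset_rfl, hU, id, by simp⟩
  obtain ⟨T, hT, hmax⟩ :=
    exists_max_image (powersetCard S U) (∑ c ∈ ·, a c) (powersetCard_nonempty.2 hU)
  obtain ⟨hTU, hTS⟩ := mem_powersetCard.1 hT
  refine ⟨T, hTU, hTS.le, fun _ => card_pos.1 (hTS ▸ hS), fun b hb => ?_⟩
  obtain ⟨hbU, hbT⟩ := mem_sdiff.1 hb
  rw [← hTS, ← nsmul_eq_mul]
  refine card_nsmul_le_sum T a _ fun c hc => ?_
  have hexchange := hmax (insert b (T.erase c)) <| mem_powersetCard.2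
    ⟨insert_subset hbU ((erase_subset c T).trans hTU), by
      rw [card_insert_of_notMem (fun h => hbT (mem_of_mem_erase h)), card_erase_add_one hc, hTS]⟩
  rw [sum_insert (fun h => hbT (mem_of_mem_erase h)), ← add_sum_erase T a hc] at hexchange
  linarith

variable {β E G : Type*} [Fintype β] [NormedAddCommGroup E] [InnerProductSpace ℝ E]
  [NormedAddCommGroup G] [NormedSpace ℝ G] {P : β → E →ₗ[ℝ] E} {x : E} {S : ℕ} {m : ℝ}

namespace IsBlockDecomposition

variable (hP : IsBlockDecomposition P)
include hP

lemma norm_blockProj_le_half_add_sum_div_sqrt {R : Finset β} (hS : 0 < S) (hm0 : 0 ≤ m)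
    (hm : ∀ b ∈ R, S * ‖P b x‖ ≤ m) :
    ‖blockProj P R x‖ ≤ (m + ∑ b ∈ R, ‖P b x‖) / √S / 2 := by
  rw [div_div, le_div_iff₀ (by positivity)]
  refine le_of_sq_le_sq ?_ (by positivity)
  have hmul : S * ‖blockProj P R x‖ ^ 2 ≤ m * ∑ b ∈ R, ‖P b x‖ := by
    rw [hP.norm_sq_blockProj, mul_sum, mul_sum]
    refine sum_le_sum fun b hb => ?_
    rw [sq, ← mul_assoc]
    exact mul_le_mul_of_nonneg_right (hm b hb) (norm_nonneg _)
  calc (‖blockProj P R x‖ * (√S * 2)) ^ 2 = 4 * (S * ‖blockProj P R x‖ ^ 2) := by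
        rw [mul_pow, mul_pow, Real.sq_sqrt (by positivity)]; ring
    _ ≤ 4 * (m * ∑ b ∈ R, ‖P b x‖) := by gcongr
    _ ≤ (m + ∑ b ∈ R, ‖P b x‖) ^ 2 := by linarith [four_mul_le_sq_add m (∑ b ∈ R, ‖P b x‖)]

lemma norm_blockProj_le_div_sqrt {T : Finset β} (hT : #T ≤ S) (hS : 0 < S) (hm0 : 0 ≤ m)
    (hm : ∀ b ∈ T, S * ‖P b x‖ ≤ m) : ‖blockProj P T x‖ ≤ m / √S := by
  refine le_of_sq_le_sq ?_ (by positivity)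
  rw [div_pow, Real.sq_sqrt (by positivity), hP.norm_sq_blockProj]
  calc ∑ b ∈ T, ‖P b x‖ ^ 2 ≤ #T • (m / S) ^ 2 := sum_le_card_nsmul T _ _ fun b hb => by
        gcongr; exact (le_div_iff₀' (by positivity)).2 (hm b hb)
    _ ≤ S * (m / S) ^ 2 := by rw [nsmul_eq_mul]; gcongr
    _ = m ^ 2 / S := by field_simp

/-- Cut `R` into shells of `S` blocks of decreasing norm: the norm on each shell is at most the
mixed norm on the preceding one divided by `√S`, and `m` plays that part for the first shell. -/
lemma norm_map_blockProj_le_mul_add_sum_div_sqrt (g : E →ₗ[ℝ] G) {C : ℝ} (hC : 0 ≤ C) (hS : 0 < S)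
    (hm0 : 0 ≤ m) {R : Finset β} (hm : ∀ b ∈ R, S * ‖P b x‖ ≤ m)
    (hg : ∀ V ⊆ R, #V ≤ S → ∀ z ∈ blockSpan P V, ‖g z‖ ≤ C * ‖z‖) :
    ‖g (blockProj P R x)‖ ≤ C * ((m + ∑ b ∈ R, ‖P b x‖) / √S) := by
  classical
  induction R using Finset.strongInduction generalizing m with
  | H R ih =>
  rcases R.eq_empty_or_nonempty with rfl | hR
  · simpa [blockProj_apply] using by positivity
  obtain ⟨T, hTR, hTS, hTne, hT⟩ := exists_subset_card_mul_le_sum (fun b => ‖P b x‖) R hS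
  have hss : R \ T ⊂ R := sdiff_ssubset hTR (hTne hR)
  have hhead : ‖g (blockProj P T x)‖ ≤ C * (m / √S) :=
    (hg T hTR hTS _ (blockProj_mem_blockSpan T x)).trans <| by
      gcongr
      exact hP.norm_blockProj_le_div_sqrt hTS hS hm0 fun b hb => hm b (hTR hb)
  have htail := ih (R \ T) hss (by positivity) hT fun V hV => hg V (hV.trans hss.1)
  calc ‖g (blockProj P R x)‖
      = ‖g (blockProj P T x) + g (blockProj P (R \ T) x)‖ := by
        rw [← map_add, ← blockProj_union disjoint_sdiff, union_sdiff_of_subset hTR]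
    _ ≤ C * (m / √S) + C * ((∑ b ∈ T, ‖P b x‖ + ∑ b ∈ R \ T, ‖P b x‖) / √S) :=
        norm_add_le_of_le hhead htail
    _ = C * ((m + ∑ b ∈ R, ‖P b x‖) / √S) := by
        rw [add_comm (∑ b ∈ T, ‖P b x‖), sum_sdiff hTR]; ring

end IsBlockDecomposition

end Shelling

/-! ### Basis pursuit denoising -/

section BasisPursuit

variable {β E F : Type*} [Fintype β] [DecidableEq β] [NormedAddCommGroup E]
  [InnerProductSpace ℝ E] [NormedAddCommGroup F] [InnerProductSpace ℝ F]
  {P : β → E →ₗ[ℝ] E} {f : E →ₗ[ℝ] F} {S : ℕ} {δ ε L : ℝ} {A T : Finset β} {h : E}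

lemma sum_compl_norm_sub_le_of_sum_norm_le {x xh : E} (A : Finset β)
    (hx : ∑ b, ‖P b xh‖ ≤ ∑ b, ‖P b x‖) :
    ∑ b ∈ Aᶜ, ‖P b (xh - x)‖ ≤ ∑ b ∈ A, ‖P b (xh - x)‖ + 2 * ∑ b ∈ Aᶜ, ‖P b x‖ := by
  have hin : ∑ b ∈ A, ‖P b x‖ ≤ ∑ b ∈ A, ‖P b xh‖ + ∑ b ∈ A, ‖P b (xh - x)‖ := by
    rw [← sum_add_distrib]
    exact sum_le_sum fun b _ => by
      rw [map_sub, norm_sub_rev]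
      exact norm_le_norm_add_norm_sub' _ _
  have hout : ∑ b ∈ Aᶜ, ‖P b (xh - x)‖ ≤ ∑ b ∈ Aᶜ, ‖P b xh‖ + ∑ b ∈ Aᶜ, ‖P b x‖ := by
    rw [← sum_add_distrib]
    exact sum_le_sum fun b _ => by rw [map_sub]; exact norm_sub_le _ _
  rw [← sum_add_sum_compl A, ← sum_add_sum_compl A] at hx
  linarith

/-- Expand `‖f u‖²` for `u = blockProj P (A ∪ T) h` as `⟪f u, f h⟫ - ⟪f u, f (h - u)⟫`; the
functional `⟪f u, f ·⟫` is small on sparse vectors supported off `A ∪ T`, hence on `h - u`. -/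
lemma BlockRIP.one_sub_mul_norm_sq_le (hP : IsBlockDecomposition P) (hf : BlockRIP P f (2 * S) δ)
    (hδ : 0 ≤ δ) (hS : 0 < S) (hA : #A ≤ S) (hT : #T ≤ S) (hAT : Disjoint A T)
    (hmax : ∀ b ∈ (A ∪ T)ᶜ, S * ‖P b h‖ ≤ ∑ c ∈ T, ‖P c h‖) :
    (1 - δ) * ‖blockProj P (A ∪ T) h‖ ^ 2 ≤ √(1 + δ) * ‖blockProj P (A ∪ T) h‖ * ‖f h‖ +
      δ * (‖blockProj P A h‖ + ‖blockProj P T h‖) *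
        ((∑ b ∈ T, ‖P b h‖ + ∑ b ∈ (A ∪ T)ᶜ, ‖P b h‖) / √S) := by
  set u := blockProj P (A ∪ T) h
  have hcard : #(A ∪ T) ≤ 2 * S := (card_union_le A T).trans (by omega)
  have hu_mem : u ∈ blockSpan P (A ∪ T) := blockProj_mem_blockSpan _ h
  have hsplit : u = blockProj P A h + blockProj P T h := blockProj_union hAT h
  have hsparse : ∀ V ⊆ (A ∪ T)ᶜ, #V ≤ S → ∀ z ∈ blockSpan P V,
      ‖(innerₗ F (f u) ∘ₗ f) z‖ ≤ δ * (‖blockProj P A h‖ + ‖blockProj P T h‖) * ‖z‖ := by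
    intro V hV hVS z hz
    have hVd : Disjoint (A ∪ T) V := (disjoint_right.2 fun b hb => mem_compl.1 (hV hb))
    obtain ⟨hVA, hVT⟩ := disjoint_union_left.1 hVd
    calc ‖⟪f u, f z⟫_ℝ‖ = |⟪f (blockProj P A h), f z⟫_ℝ + ⟪f (blockProj P T h), f z⟫_ℝ| := by
          rw [hsplit, map_add, inner_add_left, Real.norm_eq_abs]
      _ ≤ δ * ‖blockProj P A h‖ * ‖z‖ + δ * ‖blockProj P T h‖ * ‖z‖ :=
          (abs_add_le _ _).trans <| add_le_add
            (hf.abs_inner_map_le hP hVA (by omega) (blockProj_mem_blockSpan A h) hz)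
            (hf.abs_inner_map_le hP hVT (by omega) (blockProj_mem_blockSpan T h) hz)
      _ = _ := by ring
  have htail : |⟪f u, f (blockProj P (A ∪ T)ᶜ h)⟫_ℝ| ≤ _ :=
    hP.norm_map_blockProj_le_mul_add_sum_div_sqrt (innerₗ F (f u) ∘ₗ f) (by positivity) hS
      (by positivity) hmax hsparse
  have hhead : ⟪f u, f h⟫_ℝ ≤ √(1 + δ) * ‖u‖ * ‖f h‖ :=
    (real_inner_le_norm _ _).trans <| by gcongr; exact hf.norm_map_le hcard hu_mem
  have hexpand : ‖f u‖ ^ 2 = ⟪f u, f h⟫_ℝ - ⟪f u, f (blockProj P (A ∪ T)ᶜ h)⟫_ℝ := by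
    rw [← inner_sub_right, ← map_sub, ← eq_sub_of_add_eq (hP.blockProj_add_compl (A ∪ T) h),
      real_inner_self_eq_norm_sq]
  linarith [(hf _ hcard u hu_mem).1, neg_le_of_abs_le htail]

lemma one_sub_mul_le_of_rip_estimate {a h₀ h₁ w e η : ℝ} (ha : 0 ≤ a) (hh₀ : 0 ≤ h₀)
    (hh₁ : 0 ≤ h₁) (he : 0 ≤ e) (hη : 0 ≤ η) (hδ : 0 ≤ δ) (hsq : a ^ 2 = h₀ ^ 2 + h₁ ^ 2)
    (hw : w ≤ h₀ + 2 * e) (hrip : (1 - δ) * a ^ 2 ≤ a * η + δ * (h₀ + h₁) * w) :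
    (1 - 9 / 4 * δ) * a ≤ η + 2 * √2 * δ * e := by
  have hsum : h₀ + h₁ ≤ √2 * a := by
    refine le_of_sq_le_sq ?_ (by positivity)
    rw [mul_pow, Real.sq_sqrt zero_le_two]
    linarith [add_sq_le (a := h₀) (b := h₁)]
  have hprod : (h₀ + h₁) * h₀ ≤ 5 / 4 * a ^ 2 := by linarith [sq_nonneg (h₀ / 2 - h₁), sq_nonneg h₁]
  have hcross : (h₀ + h₁) * w ≤ 5 / 4 * a ^ 2 + 2 * √2 * a * e := by
    calc (h₀ + h₁) * w ≤ (h₀ + h₁) * h₀ + 2 * (h₀ + h₁) * e := by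
          linarith [mul_le_mul_of_nonneg_left hw (add_nonneg hh₀ hh₁)]
      _ ≤ 5 / 4 * a ^ 2 + 2 * (√2 * a) * e := by gcongr
      _ = _ := by ring
  have hmul := mul_le_mul_of_nonneg_left hcross hδ
  refine le_of_mul_sq_le_mul ha (by positivity) ?_
  linarith

/-- The discriminant of the quadratic in `δ` that compares the constants is negative, barely. -/
lemma c0_denominator_mul_le (δ : ℝ) :
    (1 - (1 + √2) * δ) * (1 - 9 / 4 * δ + 3 * √2 * δ) ≤ 2 * (1 - δ) * (1 - 9 / 4 * δ) := by
  have hs : √2 ^ 2 = 2 := Real.sq_sqrt zero_le_two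
  have hs' : √2 ≤ 1.44 := Real.sqrt_le_iff.2 (by norm_num)
  nlinarith [sq_nonneg (1 - (13 / 8 + √2) * δ), mul_nonneg (sub_nonneg.2 hs') (sq_nonneg δ)]

lemma one_add_sqrt_two_mul_lt_one (hδ : δ < √2 - 1) : (1 + √2) * δ < 1 := by
  have hs : √2 * √2 = 2 := Real.mul_self_sqrt zero_le_two
  nlinarith [mul_lt_mul_of_pos_left hδ (show 0 < 1 + √2 by positivity)]

lemma le_c0_mul_add_c1_mul {a n e : ℝ} (hδ0 : 0 ≤ δ) (hδ : δ < √2 - 1) (he : 0 ≤ e) (hε : 0 ≤ ε)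
    (ha : (1 - 9 / 4 * δ) * a ≤ 2 * √(1 + δ) * ε + 2 * √2 * δ * e) (hn : n ≤ 3 / 2 * a + e) :
    n ≤ c0 δ * e + c1 δ * ε := by
  have hs' : √2 ≤ 1.42 := Real.sqrt_le_iff.2 (by norm_num)
  have hD : 0 < 1 - (1 + √2) * δ := sub_pos.2 (one_add_sqrt_two_mul_lt_one hδ)
  have hq : 0 < 1 - 9 / 4 * δ := by linarith
  have hn' : (1 - 9 / 4 * δ) * n ≤
      (1 - 9 / 4 * δ + 3 * √2 * δ) * e + 3 * (√(1 + δ) * ε) := by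
    linarith [mul_le_mul_of_nonneg_left hn hq.le]
  have hc1 : 3 * (1 - (1 + √2) * δ) ≤ 4 * (1 - 9 / 4 * δ) := by nlinarith
  have hmul : (1 - (1 + √2) * δ) * n ≤ 2 * (1 - δ) * e + 4 * (√(1 + δ) * ε) := by
    refine le_of_mul_le_mul_left ?_ hq
    linarith [mul_le_mul_of_nonneg_left hn' hD.le,
      mul_le_mul_of_nonneg_right (c0_denominator_mul_le δ) he,
      mul_le_mul_of_nonneg_right hc1 (mul_nonneg (Real.sqrt_nonneg (1 + δ)) hε)]
  calc n ≤ (2 * (1 - δ) * e + 4 * (√(1 + δ) * ε)) / (1 - (1 + √2) * δ) := (le_div_iff₀' hD).2 hmul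
    _ = c0 δ * e + c1 δ * ε := by rw [c0, c1]; ring

theorem BlockRIP.norm_le_of_cone (hP : IsBlockDecomposition P) (hf : BlockRIP P f (2 * S) δ)
    (hδ0 : 0 ≤ δ) (hδ : δ < √2 - 1) (hS : 0 < S) (hA : #A ≤ S) (hL : 0 ≤ L)
    (hcone : ∑ b ∈ Aᶜ, ‖P b h‖ ≤ ∑ b ∈ A, ‖P b h‖ + 2 * L) (hfh : ‖f h‖ ≤ 2 * ε) :
    ‖h‖ ≤ c0 δ * (L / √S) + c1 δ * ε := by
  have hε : 0 ≤ ε := by linarith [norm_nonneg (f h)]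
  obtain ⟨T, hTA, hTS, -, hmax⟩ := exists_subset_card_mul_le_sum (fun b => ‖P b h‖) Aᶜ hS
  have hAT : Disjoint A T := disjoint_right.2 fun b hb => mem_compl.1 (hTA hb)
  have hcompl : (A ∪ T)ᶜ = Aᶜ \ T := by rw [compl_union, sdiff_eq_inter_compl]
  have hsum : ∑ b ∈ T, ‖P b h‖ + ∑ b ∈ (A ∪ T)ᶜ, ‖P b h‖ = ∑ b ∈ Aᶜ, ‖P b h‖ := by
    rw [hcompl, add_comm, sum_sdiff hTA]
  have hrip := hf.one_sub_mul_norm_sq_le hP hδ0 hS hA hTS hAT (by rwa [hcompl])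
  have htail := hP.norm_blockProj_le_half_add_sum_div_sqrt hS
    (sum_nonneg fun b _ => norm_nonneg _) (by rwa [hcompl] : ∀ b ∈ (A ∪ T)ᶜ, S * ‖P b h‖ ≤ _)
  rw [hsum] at hrip htail
  have hw : (∑ b ∈ Aᶜ, ‖P b h‖) / √S ≤ ‖blockProj P A h‖ + 2 * (L / √S) := by
    rw [div_le_iff₀ (by positivity), add_mul, mul_assoc, div_mul_cancel₀ _ (by positivity)]
    refine hcone.trans (add_le_add_left ((hP.sum_norm_le_sqrt_card_mul A h).trans ?_) _)
    rw [mul_comm]; gcongr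
  have ha := one_sub_mul_le_of_rip_estimate (η := √(1 + δ) * ‖f h‖) (norm_nonneg _) (norm_nonneg _)
    (norm_nonneg _) (by positivity) (by positivity) hδ0 (hP.norm_sq_blockProj_union hAT h) hw
    (by linarith)
  refine le_c0_mul_add_c1_mul hδ0 hδ (by positivity) hε (a := ‖blockProj P (A ∪ T) h‖) ?_ ?_
  · linarith [mul_le_mul_of_nonneg_left hfh (Real.sqrt_nonneg (1 + δ))]
  · have hmono := hP.norm_blockProj_mono (subset_union_left : A ⊆ A ∪ T) h
    linarith [hP.norm_le_add_compl (A ∪ T) h]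

end BasisPursuit

/-! ### The steps of CoSaMP -/

section CoSaMP

variable {β E F : Type*} [NormedAddCommGroup E] [InnerProductSpace ℝ E]
  [NormedAddCommGroup F] [InnerProductSpace ℝ F]

lemma inner_eq_zero_of_forall_norm_sub_map_le {f : E →ₗ[ℝ] F} {K : Submodule ℝ E} {y : F} {b z : E}
    (hb : b ∈ K) (hmin : ∀ b' ∈ K, ‖y - f b‖ ≤ ‖y - f b'‖) (hz : z ∈ K) :
    ⟪y - f b, f z⟫_ℝ = 0 := by
  refine ((K.map f).norm_eq_iInf_iff_real_inner_eq_zero (K.mem_map_of_mem hb)).1 ?_ _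
    (K.mem_map_of_mem hz)
  refine le_antisymm (le_ciInf ?_) (ciInf_le ⟨0, ?_⟩ (⟨f b, K.mem_map_of_mem hb⟩ : K.map f))
  · rintro ⟨_, b', hb', rfl⟩
    exact hmin b' hb'
  · rintro _ ⟨w, rfl⟩
    exact norm_nonneg _

variable [Fintype β] {P : β → E →ₗ[ℝ] E} {f : E →ₗ[ℝ] F} {n : ℕ} {δ : ℝ}
  {R V T A Ω : Finset β} {s v x b : E} {e : F}

/-! In what follows `v` is the proxy `f† (f s + e)`, characterized by its inner products. -/

lemma BlockRIP.norm_blockProj_proxy_le (hP : IsBlockDecomposition P) (hf : BlockRIP P f n δ)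
    (hδ : 0 ≤ δ) (hs : s ∈ blockSpan P R) (hv : ∀ z, ⟪v, z⟫_ℝ = ⟪f s + e, f z⟫_ℝ)
    (hRV : Disjoint R V) (hn : #R + #V ≤ n) :
    ‖blockProj P V v‖ ≤ δ * ‖s‖ + √(1 + δ) * ‖e‖ := by
  set q := blockProj P V v with hq
  have hq_mem : q ∈ blockSpan P V := blockProj_mem_blockSpan V v
  have hinner : ‖q‖ ^ 2 = ⟪f s, f q⟫_ℝ + ⟪e, f q⟫_ℝ := by
    rw [← inner_add_left, ← hv, hq, hP.inner_blockProj_self]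
  have hsignal := le_of_abs_le (hf.abs_inner_map_le hP hRV hn hs hq_mem)
  have hnoise : ⟪e, f q⟫_ℝ ≤ ‖e‖ * (√(1 + δ) * ‖q‖) :=
    (real_inner_le_norm _ _).trans (by gcongr; exact hf.norm_map_le (by omega) hq_mem)
  rw [← one_mul ‖q‖]
  refine le_of_mul_sq_le_mul (norm_nonneg q) (by positivity) ?_
  linarith

lemma BlockRIP.one_sub_mul_norm_blockProj_le_add_proxy (hP : IsBlockDecomposition P)
    (hf : BlockRIP P f n δ) (hδ : 0 ≤ δ) (hs : s ∈ blockSpan P R)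
    (hv : ∀ z, ⟪v, z⟫_ℝ = ⟪f s + e, f z⟫_ℝ) (hVR : V ⊆ R) (hn : #R ≤ n) :
    (1 - δ) * ‖blockProj P V s‖ ≤ δ * ‖s‖ + √(1 + δ) * ‖e‖ + ‖blockProj P V v‖ := by
  classical
  set r := blockProj P V s with hr
  set t := blockProj P (R \ V) s with ht
  have hr_mem : r ∈ blockSpan P V := blockProj_mem_blockSpan V s
  have hsrt : s = r + t := by
    rw [hr, ht, ← blockProj_union disjoint_sdiff, union_sdiff_of_subset hVR,
      hP.mem_blockSpan_iff.1 hs]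
  have hts : ‖t‖ ≤ ‖s‖ := hP.norm_blockProj_le _ s
  have hcard : #(R \ V) + #V ≤ n := by rwa [card_sdiff_add_card_eq_card hVR]
  have hexpand : ‖f r‖ ^ 2 = ⟪v, r⟫_ℝ - ⟪e, f r⟫_ℝ - ⟪f t, f r⟫_ℝ := by
    have hfs : ⟪f s, f r⟫_ℝ = ‖f r‖ ^ 2 + ⟪f t, f r⟫_ℝ := by
      rw [← real_inner_self_eq_norm_sq, ← inner_add_left, ← map_add, ← hsrt]
    rw [hv, inner_add_left, hfs]; ring
  have hproxy : ⟪v, r⟫_ℝ ≤ ‖blockProj P V v‖ * ‖r‖ := by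
    rw [← hP.mem_blockSpan_iff.1 hr_mem, ← hP.isSymmetric_blockProj, hP.mem_blockSpan_iff.1 hr_mem]
    exact real_inner_le_norm _ _
  have hnoise := neg_le_of_abs_le <| (abs_real_inner_le_norm e (f r)).trans
    (mul_le_mul_of_nonneg_left (hf.norm_map_le ((card_le_card hVR).trans hn) hr_mem)
      (norm_nonneg e))
  have hrest := neg_le_of_abs_le (hf.abs_inner_map_le hP sdiff_disjoint hcard
    (blockProj_mem_blockSpan (R \ V) s) hr_mem)
  refine le_of_mul_sq_le_mul (norm_nonneg r) (by positivity) ?_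
  linarith [(hf V ((card_le_card hVR).trans hn) r hr_mem).1,
    mul_le_mul_of_nonneg_left (mul_le_mul_of_nonneg_right hts (norm_nonneg r)) hδ]

variable [DecidableEq β]

lemma IsBlockDecomposition.norm_blockProj_sdiff_le_sdiff (hP : IsBlockDecomposition P)
    (hv : ‖blockProj P Ωᶜ v‖ ≤ ‖blockProj P Rᶜ v‖) :
    ‖blockProj P (R \ Ω) v‖ ≤ ‖blockProj P (Ω \ R) v‖ := by
  have hsplit (U W : Finset β) : ‖blockProj P Wᶜ v‖ ^ 2 =
      ‖blockProj P (U \ W) v‖ ^ 2 + ‖blockProj P (U ∪ W)ᶜ v‖ ^ 2 := by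
    rw [← hP.norm_sq_blockProj_union]
    · congr; ext; simp; tauto
    · exact disjoint_compl_right.mono_left (sdiff_subset.trans subset_union_left)
  refine le_of_sq_le_sq ?_ (norm_nonneg _)
  have hsq := pow_le_pow_left₀ (norm_nonneg _) hv 2
  rw [hsplit R Ω, hsplit Ω R, union_comm] at hsq
  exact le_of_add_le_add_right hsq

lemma BlockRIP.one_sub_mul_norm_blockProj_compl_le (hP : IsBlockDecomposition P)
    (hf : BlockRIP P f n δ) (hδ : 0 ≤ δ) (hs : s ∈ blockSpan P R)
    (hv : ∀ z, ⟪v, z⟫_ℝ = ⟪f s + e, f z⟫_ℝ) (hn : #R + #Ω ≤ n)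
    (hΩ : ‖blockProj P Ωᶜ v‖ ≤ ‖blockProj P Rᶜ v‖) :
    (1 - δ) * ‖blockProj P Ωᶜ s‖ ≤ 2 * (δ * ‖s‖ + √(1 + δ) * ‖e‖) := by
  have hsΩ : blockProj P Ωᶜ s = blockProj P (R \ Ω) s := by
    rw [← hP.mem_blockSpan_iff.1 hs, hP.blockProj_blockProj, hP.blockProj_blockProj]
    congr 2; ext; simp; tauto
  have hcard : #(Ω \ R) ≤ #Ω := card_le_card sdiff_subset
  have hmissed := hf.one_sub_mul_norm_blockProj_le_add_proxy hP hδ hs hv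
    (sdiff_subset (s := R) (t := Ω)) (by omega)
  have hfalse :=
    hf.norm_blockProj_proxy_le hP hδ hs hv (disjoint_sdiff (s := R) (t := Ω)) (by omega)
  rw [hsΩ]
  linarith [hP.norm_blockProj_sdiff_le_sdiff hΩ]

lemma BlockRIP.one_sub_mul_norm_sub_leastSquares_le (hP : IsBlockDecomposition P)
    (hf : BlockRIP P f n δ) (hδ0 : 0 ≤ δ) (hδ1 : δ ≤ 1) (hx : x ∈ blockSpan P A)
    (hb : b ∈ blockSpan P T) (hn : #A + #T ≤ n)
    (hmin : ∀ b' ∈ blockSpan P T, ‖f x + e - f b‖ ≤ ‖f x + e - f b'‖) :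
    (1 - δ) * ‖x - b‖ ≤ ‖blockProj P Tᶜ x‖ + √(1 + δ) * ‖e‖ := by
  set u := blockProj P T (x - b)
  set t := blockProj P Tᶜ x with ht
  have hu_mem : u ∈ blockSpan P T := blockProj_mem_blockSpan T _
  have ht_mem : t ∈ blockSpan P (Tᶜ ∩ A) := by
    rw [ht, ← hP.mem_blockSpan_iff.1 hx, hP.blockProj_blockProj]
    exact blockProj_mem_blockSpan _ x
  have hut : u + t = x - b := by
    rw [ht, ← sub_zero (blockProj P Tᶜ x),
      ← hP.blockProj_eq_zero_of_disjoint disjoint_compl_left hb, ← map_sub,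
      hP.blockProj_add_compl]
  have horth := inner_eq_zero_of_forall_norm_sub_map_le hb hmin hu_mem
  rw [show f x + e - f b = f u + f t + e by rw [← map_add, hut, map_sub]; abel,
    inner_add_left, inner_add_left, real_inner_self_eq_norm_sq] at horth
  have hcard : #(Tᶜ ∩ A) ≤ #A := card_le_card inter_subset_right
  have hcross := neg_le_of_abs_le (hf.abs_inner_map_le hP
    (disjoint_compl_left.mono_left inter_subset_left) (by omega) ht_mem hu_mem)
  have hnoise := neg_le_of_abs_le <| (abs_real_inner_le_norm e (f u)).trans
    (mul_le_mul_of_nonneg_left (hf.norm_map_le (by omega) hu_mem) (norm_nonneg e))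
  have hu_le : (1 - δ) * ‖u‖ ≤ δ * ‖t‖ + √(1 + δ) * ‖e‖ := by
    refine le_of_mul_sq_le_mul (norm_nonneg u) (by positivity) ?_
    linarith [(hf T (by omega) u hu_mem).1]
  calc (1 - δ) * ‖x - b‖ ≤ (1 - δ) * (‖u‖ + ‖t‖) := by
        rw [← hut]; exact mul_le_mul_of_nonneg_left (norm_add_le u t) (sub_nonneg.2 hδ1)
    _ ≤ ‖t‖ + √(1 + δ) * ‖e‖ := by linarith

end CoSaMP

/-! ### Group sparse vectors -/

section Groups

variable {ι ρ β : Type*} [Fintype ι]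

lemma l2norm_sq (v : ι → ℂ) : l2norm v ^ 2 = ∑ j, ‖v j‖ ^ 2 := by
  rw [l2norm, EuclideanSpace.norm_sq_eq]

lemma l2norm_nonneg (v : ι → ℂ) : 0 ≤ l2norm v := norm_nonneg _

lemma real_inner_euclidean (x y : EuclideanSpace ℂ ι) :
    ⟪x, y⟫_ℝ = (∑ j, ⟪x j, y j⟫_ℂ).re := by
  rw [PiLp.inner_apply, Complex.re_sum]
  rfl

/-- The restriction of a vector to the group with label `b`, with zeros elsewhere. It is the
subvector `x[b]`, regarded as a vector with the full index set. -/
def groupProj [DecidableEq β] (g : ι → β) (b : β) :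
    EuclideanSpace ℂ ι →ₗ[ℝ] EuclideanSpace ℂ ι where
  toFun x := WithLp.toLp 2 fun j => if g j = b then x j else 0
  map_add' x y := by ext j; simp only [PiLp.add_apply]; split_ifs <;> simp
  map_smul' c x := by ext j; simp only [PiLp.smul_apply, RingHom.id_apply]; split_ifs <;> simp

/-- The real-linear map between Euclidean spaces given by a complex matrix. -/
def matMap (Φ : Matrix ρ ι ℂ) : EuclideanSpace ℂ ι →ₗ[ℝ] EuclideanSpace ℂ ρ where
  toFun x := WithLp.toLp 2 (Φ *ᵥ x.ofLp)
  map_add' x y := by simp [Matrix.mulVec_add]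
  map_smul' c x := by simp [Matrix.mulVec_smul]

lemma inner_conjTranspose_mulVec [Fintype ρ] (Φ : Matrix ρ ι ℂ) (r : ρ → ℂ)
    (z : EuclideanSpace ℂ ι) :
    ⟪WithLp.toLp 2 (Φᴴ *ᵥ r), z⟫_ℝ = ⟪WithLp.toLp 2 r, matMap Φ z⟫_ℝ := by
  rw [real_inner_euclidean, real_inner_euclidean]
  congr 1
  change z.ofLp ⬝ᵥ star (Φᴴ *ᵥ r) = (Φ *ᵥ z.ofLp) ⬝ᵥ star r
  rw [Matrix.star_mulVec, Matrix.conjTranspose_conjTranspose, dotProduct_comm,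
    ← Matrix.dotProduct_mulVec, dotProduct_comm]

section Projections

variable [DecidableEq β] (g : ι → β)

omit [Fintype ι] in
lemma groupProj_apply (b : β) (x : EuclideanSpace ℂ ι) (j : ι) :
    groupProj g b x j = if g j = b then x j else 0 := rfl

lemma blockProj_groupProj_apply (V : Finset β) (x : EuclideanSpace ℂ ι) (j : ι) :
    blockProj (groupProj g) V x j = if g j ∈ V then x j else 0 := by
  simp [blockProj_apply, groupProj_apply]

lemma isBlockDecomposition_groupProj [Fintype β] : IsBlockDecomposition (groupProj g) where
  idem b := by
    ext x j
    simp only [Module.End.mul_apply, groupProj_apply]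
    split_ifs <;> rfl
  ortho b c hbc := by
    ext x j
    simp only [Module.End.mul_apply, groupProj_apply, LinearMap.zero_apply, PiLp.zero_apply]
    split_ifs with hb hc
    · exact absurd (hb.symm.trans hc) hbc
    all_goals rfl
  complete := by
    ext x j
    simp [groupProj_apply]
  isSymmetric b x y := by
    simp only [real_inner_euclidean, groupProj_apply]
    congr 1
    refine sum_congr rfl fun j _ => ?_
    split_ifs <;> simp

lemma norm_groupProj (x : ι → ℂ) (b : β) :
    ‖groupProj g b (WithLp.toLp 2 x)‖ = l2norm (subvec g x b) := by
  refine (pow_left_inj₀ (norm_nonneg _) (l2norm_nonneg _) two_ne_zero).1 ?_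
  calc ‖groupProj g b (WithLp.toLp 2 x)‖ ^ 2
      = ∑ j with g j = b, ‖x j‖ ^ 2 := by
        rw [EuclideanSpace.norm_sq_eq, sum_filter]
        refine sum_congr rfl fun j _ => ?_
        rw [groupProj_apply]
        split_ifs <;> simp
    _ = l2norm (subvec g x b) ^ 2 := by
        rw [l2norm_sq]
        exact sum_subtype _ (by simp) _

lemma mixedNorm_eq_sum_norm_groupProj [Fintype β] (x : ι → ℂ) :
    mixedNorm g x = ∑ b, ‖groupProj g b (WithLp.toLp 2 x)‖ := by
  simp only [mixedNorm, norm_groupProj]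

lemma mem_blockSpan_groupProj_iff [Finite β] {g : ι → β} {V : Finset β}
    {x : EuclideanSpace ℂ ι} :
    x ∈ blockSpan (groupProj g) V ↔ groupSupp g x.ofLp ⊆ V := by
  cases nonempty_fintype β
  rw [(isBlockDecomposition_groupProj g).mem_blockSpan_iff]
  constructor
  · intro h b hb
    by_contra hbV
    refine hb (funext fun j => ?_)
    have hj := congrArg (fun z : EuclideanSpace ℂ ι => z j) h
    simp only [blockProj_groupProj_apply, j.2, mem_coe.not.1 hbV, if_false] at hj
    exact hj.symm
  · intro h
    ext j
    rw [blockProj_groupProj_apply]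
    split_ifs with hj
    · rfl
    · by_contra hne
      exact hj (h (a := g j) fun h0 => hne (congrFun h0 ⟨j, rfl⟩).symm)

end Projections

section Support

variable [Finite β] {g : ι → β} {S : ℕ}

/-- The group support as a finite set of labels, the form in which it indexes block projections. -/
def suppFinset (g : ι → β) (x : ι → ℂ) : Finset β := (Set.toFinite (groupSupp g x)).toFinset

omit [Fintype ι] in
lemma coe_suppFinset (g : ι → β) (x : ι → ℂ) : (suppFinset g x : Set β) = groupSupp g x := by
  simp [suppFinset]

omit [Fintype ι] in
lemma groupSparse_iff_card_suppFinset {x : ι → ℂ} : GroupSparse g S x ↔ #(suppFinset g x) ≤ S := by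
  rw [GroupSparse, ← coe_suppFinset, Set.ncard_coe_finset]

omit [Fintype ι] [Finite β] in
lemma groupSparse_zero (g : ι → β) (S : ℕ) : GroupSparse g S 0 := by
  have h : groupSupp g 0 = ∅ := Set.eq_empty_iff_forall_notMem.2 fun b hb => hb rfl
  simp [GroupSparse, h]

lemma mem_blockSpan_suppFinset [DecidableEq β] (g : ι → β) (x : ι → ℂ) :
    WithLp.toLp 2 x ∈ blockSpan (groupProj g) (suppFinset g x) := by
  rw [mem_blockSpan_groupProj_iff, coe_suppFinset]

lemma groupSparse_of_mem_blockSpan [DecidableEq β] {V : Finset β} (hV : #V ≤ S)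
    {x : EuclideanSpace ℂ ι} (hx : x ∈ blockSpan (groupProj g) V) : GroupSparse g S x.ofLp := by
  have hsupp := Set.ncard_le_ncard (mem_blockSpan_groupProj_iff.1 hx) V.finite_toSet
  rw [Set.ncard_coe_finset] at hsupp
  exact hsupp.trans hV

end Support

/-! ### Group restricted isometry constants -/

section GRIP

variable [Fintype ρ] {g : ι → β} {n : ℕ} {Φ : Matrix ρ ι ℂ} {δ δ' : ℝ}

lemma blockRIP_of_gRIPWith [Finite β] [DecidableEq β] (h : GRIPWith g n Φ δ) :
    BlockRIP (groupProj g) (matMap Φ) n δ :=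
  fun _ hV x hx => h x.ofLp (groupSparse_of_mem_blockSpan hV hx)

lemma GRIPWith.mono (h : GRIPWith g n Φ δ) (hδ : δ ≤ δ') : GRIPWith g n Φ δ' := fun x hx =>
  ⟨le_trans (by gcongr) (h x hx).1, (h x hx).2.trans (by gcongr)⟩

lemma isClosed_setOf_gRIPWith (g : ι → β) (n : ℕ) (Φ : Matrix ρ ι ℂ) :
    IsClosed {δ : ℝ | GRIPWith g n Φ δ} := by
  simp only [GRIPWith, Set.ofPred_forall]
  refine isClosed_iInter fun x => isClosed_iInter fun _ => ?_
  have hlower : IsClosed {δ : ℝ | (1 - δ) * l2norm x ^ 2 ≤ l2norm (Φ *ᵥ x) ^ 2} :=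
    isClosed_le (by fun_prop) continuous_const
  have hupper : IsClosed {δ : ℝ | l2norm (Φ *ᵥ x) ^ 2 ≤ (1 + δ) * l2norm x ^ 2} :=
    isClosed_le continuous_const (by fun_prop)
  exact hlower.inter hupper

lemma gRIC_nonneg (g : ι → β) (n : ℕ) (Φ : Matrix ρ ι ℂ) : 0 ≤ gRIC g n Φ :=
  Real.sInf_nonneg fun _ h => h.1

lemma bddBelow_gRIPWith (g : ι → β) (n : ℕ) (Φ : Matrix ρ ι ℂ) :
    BddBelow {δ : ℝ | 0 ≤ δ ∧ GRIPWith g n Φ δ} := ⟨0, fun _ h => h.1⟩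

lemma gRIC_le (hδ : 0 ≤ δ) (h : GRIPWith g n Φ δ) : gRIC g n Φ ≤ δ :=
  csInf_le (bddBelow_gRIPWith g n Φ) ⟨hδ, h⟩

lemma GRIPWith.gRIPWith_gRIC (hδ : 0 ≤ δ) (h : GRIPWith g n Φ δ) :
    GRIPWith g n Φ (gRIC g n Φ) :=
  ((isClosed_Ici.inter (isClosed_setOf_gRIPWith g n Φ)).csInf_mem ⟨δ, hδ, h⟩
    (bddBelow_gRIPWith g n Φ)).2

lemma HasGRIP.gRIPWith_gRIC (h : HasGRIP g n Φ) : GRIPWith g n Φ (gRIC g n Φ) :=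
  let ⟨_, hδ, _, hΦ⟩ := h
  hΦ.gRIPWith_gRIC hδ.le

variable {o : Type*} [Fintype o] [DecidableEq o]

omit [Fintype ρ] in
lemma blockDiagonal_mulVec_apply (Φ : o → Matrix ρ ι ℂ) (x : ι × o → ℂ) (q : ρ) (θ : o) :
    (Matrix.blockDiagonal Φ *ᵥ x) (q, θ) = (Φ θ *ᵥ fun j => x (j, θ)) q := by
  simp only [Matrix.mulVec, dotProduct, Fintype.sum_prod_type, Matrix.blockDiagonal_apply,
    ite_mul, zero_mul, sum_ite_eq, mem_univ, if_true]

omit [DecidableEq o] in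
lemma l2norm_sq_prod (x : ι × o → ℂ) : l2norm x ^ 2 = ∑ θ, l2norm (fun j => x (j, θ)) ^ 2 := by
  simp only [l2norm_sq, Fintype.sum_prod_type_right]

lemma gRIPWith_blockDiagonal [Finite β] {Φ : o → Matrix ρ ι ℂ} (h : ∀ θ, GRIPWith g n (Φ θ) δ) :
    GRIPWith (fun jθ : ι × o => g jθ.1) n (Matrix.blockDiagonal Φ) δ := by
  intro x hx
  have hslice (θ : o) : GroupSparse g n fun j => x (j, θ) := by
    refine (Set.ncard_le_ncard ?_ (Set.toFinite _)).trans hx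
    exact fun b hb h0 => hb (funext fun j => congrFun h0 ⟨(j, θ), j.2⟩)
  simp only [l2norm_sq_prod x, l2norm_sq_prod (Matrix.blockDiagonal Φ *ᵥ x),
    blockDiagonal_mulVec_apply, mul_sum]
  exact ⟨sum_le_sum fun θ _ => (h θ _ (hslice θ)).1, sum_le_sum fun θ _ => (h θ _ (hslice θ)).2⟩

end GRIP

/-! ### Error bounds for the two recovery methods -/

section Recovery

variable [Fintype ρ] {g : ι → β} {S n : ℕ} {Φ : Matrix ρ ι ℂ}
  {y : ρ → ℂ} {ε δ : ℝ} {x x' xh xA : ι → ℂ} {A R : Finset β}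

section

variable [Fintype β] [DecidableEq β]

theorem IsGBPDNSolution.l2norm_sub_le (hxh : IsGBPDNSolution g Φ y ε xh)
    (hx : l2norm (Φ *ᵥ x - y) ≤ ε) (hS : 0 < S) (hδ0 : 0 ≤ δ) (hδ1 : δ < √2 - 1)
    (hΦ : GRIPWith g (2 * S) Φ δ) (hA : #A ≤ S) :
    l2norm (xh - x) ≤ c0 δ * ((∑ b ∈ Aᶜ, l2norm (subvec g x b)) / √S) + c1 δ * ε := by
  have hmin := hxh.2 x hx
  rw [mixedNorm_eq_sum_norm_groupProj, mixedNorm_eq_sum_norm_groupProj] at hmin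
  have hres : ‖matMap Φ (WithLp.toLp 2 xh - WithLp.toLp 2 x)‖ ≤ 2 * ε := by
    have hsub : matMap Φ (WithLp.toLp 2 xh - WithLp.toLp 2 x) =
        WithLp.toLp 2 (Φ *ᵥ xh - y) - WithLp.toLp 2 (Φ *ᵥ x - y) := by
      rw [map_sub, WithLp.toLp_sub, WithLp.toLp_sub, sub_sub_sub_cancel_right]
      rfl
    rw [hsub, two_mul]
    exact (norm_sub_le _ _).trans (add_le_add hxh.1 hx)
  simp only [← norm_groupProj]
  exact (blockRIP_of_gRIPWith hΦ).norm_le_of_cone (isBlockDecomposition_groupProj g) hδ0 hδ1 hS hA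
    (sum_nonneg fun _ _ => norm_nonneg _) (sum_compl_norm_sub_le_of_sum_norm_le A hmin) hres

lemma IsBestGroupApprox.norm_blockProj_compl_le {v w : ι → ℂ} (h : IsBestGroupApprox g n v w)
    (hR : #R ≤ n) :
    ‖blockProj (groupProj g) (suppFinset g w)ᶜ (WithLp.toLp 2 v)‖ ≤
      ‖blockProj (groupProj g) Rᶜ (WithLp.toLp 2 v)‖ := by
  have hP := isBlockDecomposition_groupProj g
  set v₂ : EuclideanSpace ℂ ι := WithLp.toLp 2 v
  set w₂ : EuclideanSpace ℂ ι := WithLp.toLp 2 w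
  have hw : blockProj (groupProj g) (suppFinset g w)ᶜ w₂ = 0 :=
    hP.blockProj_eq_zero_of_disjoint disjoint_compl_left (mem_blockSpan_suppFinset g w)
  calc ‖blockProj (groupProj g) (suppFinset g w)ᶜ v₂‖
      = ‖blockProj (groupProj g) (suppFinset g w)ᶜ (v₂ - w₂)‖ := by rw [map_sub, hw, sub_zero]
    _ ≤ ‖v₂ - w₂‖ := hP.norm_blockProj_le _ _
    _ ≤ ‖v₂ - blockProj (groupProj g) R v₂‖ :=
        h.2 _ (groupSparse_of_mem_blockSpan hR (blockProj_mem_blockSpan R v₂))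
    _ = ‖blockProj (groupProj g) Rᶜ v₂‖ := by
        rw [sub_eq_of_eq_add' (hP.blockProj_add_compl R v₂).symm]

lemma IsGroupLeastSquares.one_sub_mul_norm_sub_le {T : Finset β} {b : ι → ℂ}
    (h : IsGroupLeastSquares g Φ y T b) (hΦ : GRIPWith g n Φ δ) (hδ0 : 0 ≤ δ) (hδ1 : δ ≤ 1)
    (hn : #(suppFinset g xA) + #T ≤ n) :
    (1 - δ) * l2norm (xA - b) ≤ ‖blockProj (groupProj g) Tᶜ (WithLp.toLp 2 xA)‖ +
      √(1 + δ) * l2norm (y - Φ *ᵥ xA) := by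
  have hy (z : EuclideanSpace ℂ ι) : matMap Φ (WithLp.toLp 2 xA) +
      WithLp.toLp 2 (y - Φ *ᵥ xA) - matMap Φ z = WithLp.toLp 2 (y - Φ *ᵥ z.ofLp) := by
    rw [matMap]
    ext q
    simp
  refine (blockRIP_of_gRIPWith hΦ).one_sub_mul_norm_sub_leastSquares_le
    (isBlockDecomposition_groupProj g) hδ0 hδ1 (mem_blockSpan_suppFinset g xA)
    (mem_blockSpan_groupProj_iff.2 h.1) hn fun b' hb' => ?_
  rw [hy, hy]
  exact h.2 b'.ofLp (mem_blockSpan_groupProj_iff.1 hb')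

lemma IsBestGroupApprox.one_sub_mul_norm_blockProj_compl_union_le {w : ι → ℂ}
    (h : IsBestGroupApprox g (2 * S) (Φᴴ *ᵥ (y - Φ *ᵥ x)) w) (hΦ : GRIPWith g (4 * S) Φ δ)
    (hδ0 : 0 ≤ δ) (hδ1 : δ ≤ 1) (hx : GroupSparse g S x) (hxA : GroupSparse g S xA) :
    (1 - δ) * ‖blockProj (groupProj g) (suppFinset g w ∪ suppFinset g x)ᶜ (WithLp.toLp 2 xA)‖ ≤
      2 * (δ * l2norm (xA - x) + √(1 + δ) * l2norm (y - Φ *ᵥ xA)) := by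
  have hP := isBlockDecomposition_groupProj g
  have hf := blockRIP_of_gRIPWith hΦ
  set Ω := suppFinset g w
  set X := suppFinset g x
  set A := suppFinset g xA
  set s : EuclideanSpace ℂ ι := WithLp.toLp 2 (xA - x) with hs
  have hx_mem : WithLp.toLp 2 x ∈ blockSpan (groupProj g) X := mem_blockSpan_suppFinset g x
  have hs_mem : s ∈ blockSpan (groupProj g) (A ∪ X) :=
    sub_mem (hP.blockSpan_mono subset_union_left (mem_blockSpan_suppFinset g xA))
      (hP.blockSpan_mono subset_union_right hx_mem)
  have hcard : #(A ∪ X) ≤ 2 * S := (card_union_le _ _).trans <| by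
    linarith [groupSparse_iff_card_suppFinset.1 hx, groupSparse_iff_card_suppFinset.1 hxA]
  have hcardΩ : #Ω ≤ 2 * S := groupSparse_iff_card_suppFinset.1 h.1
  have hres : WithLp.toLp 2 (y - Φ *ᵥ x) = matMap Φ s + WithLp.toLp 2 (y - Φ *ᵥ xA) := by
    rw [hs, matMap]
    ext q
    simp [Matrix.mulVec_sub]
  have htail : blockProj (groupProj g) (Ω ∪ X)ᶜ (WithLp.toLp 2 xA) =
      blockProj (groupProj g) (Ω ∪ X)ᶜ s := by
    rw [hs, WithLp.toLp_sub, map_sub, hP.blockProj_eq_zero_of_disjoint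
      (disjoint_compl_left.mono_right subset_union_right) hx_mem, sub_zero]
  calc (1 - δ) * ‖blockProj (groupProj g) (Ω ∪ X)ᶜ (WithLp.toLp 2 xA)‖
      ≤ (1 - δ) * ‖blockProj (groupProj g) Ωᶜ s‖ := by
        rw [htail]
        gcongr
        exact hP.norm_blockProj_mono (compl_subset_compl.2 subset_union_left) s
    _ ≤ _ := hf.one_sub_mul_norm_blockProj_compl_le hP hδ0 hs_mem
        (fun z => by rw [inner_conjTranspose_mulVec, hres]) (by omega)
        (h.norm_blockProj_compl_le hcard)

end

lemma IsBestGroupApprox.l2norm_sub_le {v w u : ι → ℂ} (h : IsBestGroupApprox g n v w)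
    (hu : GroupSparse g n u) : l2norm (u - w) ≤ 2 * l2norm (u - v) := by
  have htri := norm_sub_le_norm_sub_add_norm_sub (WithLp.toLp 2 u : EuclideanSpace ℂ ι)
    (WithLp.toLp 2 v) (WithLp.toLp 2 w)
  have hbest := h.2 u hu
  rw [l2norm, l2norm, WithLp.toLp_sub, WithLp.toLp_sub, norm_sub_rev _ (WithLp.toLp 2 u)] at hbest
  rw [l2norm, l2norm, WithLp.toLp_sub, WithLp.toLp_sub]
  linarith

lemma IsGCoSaMPStep.sq_one_sub_mul_l2norm_sub_le [Finite β] (h : IsGCoSaMPStep g S Φ y x x')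
    (hδ0 : 0 ≤ δ) (hδ1 : δ ≤ 1) (hΦ : GRIPWith g (4 * S) Φ δ) (hx : GroupSparse g S x)
    (hxA : GroupSparse g S xA) :
    (1 - δ) ^ 2 * l2norm (xA - x') ≤ 4 * δ * l2norm (xA - x) +
      (6 - 2 * δ) * √(1 + δ) * l2norm (y - Φ *ᵥ xA) := by
  classical
  cases nonempty_fintype β
  obtain ⟨w, b, hw, hb, hx'⟩ := h
  rw [← coe_suppFinset, ← coe_suppFinset, ← coe_union] at hb
  have hcard : #(suppFinset g xA) + #(suppFinset g w ∪ suppFinset g x) ≤ 4 * S := by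
    have := card_union_le (suppFinset g w) (suppFinset g x)
    linarith [groupSparse_iff_card_suppFinset.1 hx, groupSparse_iff_card_suppFinset.1 hxA,
      groupSparse_iff_card_suppFinset.1 hw.1]
  have hsolve := hb.one_sub_mul_norm_sub_le hΦ hδ0 hδ1 hcard
  have hidentify := hw.one_sub_mul_norm_blockProj_compl_union_le hΦ hδ0 hδ1 hx hxA
  have hprune := hx'.l2norm_sub_le hxA
  have : 0 ≤ 1 - δ := sub_nonneg.2 hδ1
  calc (1 - δ) ^ 2 * l2norm (xA - x')
      ≤ (1 - δ) ^ 2 * (2 * l2norm (xA - b)) := by gcongr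
    _ = 2 * (1 - δ) * ((1 - δ) * l2norm (xA - b)) := by ring
    _ ≤ 2 * (1 - δ) * (_ + √(1 + δ) * l2norm (y - Φ *ᵥ xA)) := by gcongr
    _ ≤ _ := by linarith

lemma sqrt_one_add_tenth_le : √(1 + 0.1) ≤ 1.05 :=
  Real.sqrt_le_iff.2 (by norm_num)

lemma IsGCoSaMPStep.l2norm_sub_le [Finite β] (h : IsGCoSaMPStep g S Φ y x x')
    (hΦ : GRIPWith g (4 * S) Φ 0.1) (hx : GroupSparse g S x) (hxA : GroupSparse g S xA) :
    l2norm (xA - x') ≤ 1 / 2 * l2norm (xA - x) + 7.55 * l2norm (y - Φ *ᵥ xA) := by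
  have hstep := h.sq_one_sub_mul_l2norm_sub_le (by norm_num) (by norm_num) hΦ hx hxA
  have hnoise : √(1 + 0.1) * l2norm (y - Φ *ᵥ xA) ≤ 1.05 * l2norm (y - Φ *ᵥ xA) :=
    mul_le_mul_of_nonneg_right sqrt_one_add_tenth_le (l2norm_nonneg _)
  linarith [l2norm_nonneg (xA - x), l2norm_nonneg (y - Φ *ᵥ xA)]

lemma IsGCoSaMPIterate.groupSparse (h : IsGCoSaMPIterate g S Φ y n xh) : GroupSparse g S xh := by
  cases h with
  | zero => exact groupSparse_zero g S
  | succ _ hstep =>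
    obtain ⟨_, _, _, _, hx'⟩ := hstep
    exact hx'.1

lemma IsGCoSaMPIterate.l2norm_sub_le_of_groupSparse [Finite β]
    (h : IsGCoSaMPIterate g S Φ y n xh) (hΦ : GRIPWith g (4 * S) Φ 0.1) (hxA : GroupSparse g S xA) :
    l2norm (xA - xh) ≤ 1 / 2 ^ n * l2norm xA + 15.1 * l2norm (y - Φ *ᵥ xA) := by
  induction h with
  | zero =>
    simp only [sub_zero, pow_zero]
    linarith [l2norm_nonneg (y - Φ *ᵥ xA)]
  | succ h hstep ih =>
    rw [pow_succ, one_div, mul_inv, ← one_div]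
    linarith [hstep.l2norm_sub_le hΦ h.groupSparse hxA]

variable [DecidableEq β]

lemma norm_blockProj_groupProj_le_sum (A : Finset β) (x : ι → ℂ) :
    ‖blockProj (groupProj g) A (WithLp.toLp 2 x)‖ ≤ ∑ b ∈ A, l2norm (subvec g x b) := by
  simp only [blockProj_apply, ← norm_groupProj]
  exact norm_sum_le _ _

lemma BlockRIP.norm_map_blockProj_le_sum {f : EuclideanSpace ℂ ι →ₗ[ℝ] EuclideanSpace ℂ ρ}
    (hf : BlockRIP (groupProj g) f n δ) (hn : 0 < n) (A : Finset β) (x : ι → ℂ) :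
    ‖f (blockProj (groupProj g) A (WithLp.toLp 2 x))‖ ≤
      √(1 + δ) * ∑ b ∈ A, l2norm (subvec g x b) := by
  rw [blockProj_apply, map_sum, mul_sum]
  refine (norm_sum_le _ _).trans (sum_le_sum fun b _ => ?_)
  rw [← norm_groupProj, ← blockProj_singleton (P := groupProj g)]
  exact hf.norm_map_le (by rwa [card_singleton]) (blockProj_mem_blockSpan _ _)

theorem IsGCoSaMPIterate.l2norm_sub_le [Fintype β] (h : IsGCoSaMPIterate g S Φ y n xh)
    (hS : 0 < S) (hΦ : GRIPWith g (4 * S) Φ 0.1) (hx : l2norm (Φ *ᵥ x - y) ≤ ε) (hA : #A ≤ S) :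
    l2norm (xh - x) ≤ 20 * (1 + 1 / √S) * (∑ b ∈ Aᶜ, l2norm (subvec g x b)) + 20 * ε +
      1 / 2 ^ n * l2norm x := by
  have hP := isBlockDecomposition_groupProj g
  set x₂ : EuclideanSpace ℂ ι := WithLp.toLp 2 x
  set xh₂ : EuclideanSpace ℂ ι := WithLp.toLp 2 xh
  set head := blockProj (groupProj g) A x₂
  set tail := blockProj (groupProj g) Aᶜ x₂
  set leak := ∑ b ∈ Aᶜ, l2norm (subvec g x b)
  have hleak : 0 ≤ leak := sum_nonneg fun _ _ => l2norm_nonneg _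
  have hsplit : x₂ = head + tail := (hP.blockProj_add_compl A x₂).symm
  have htail : ‖tail‖ ≤ leak := norm_blockProj_groupProj_le_sum _ x
  have hftail : ‖matMap Φ tail‖ ≤ 1.05 * leak :=
    ((blockRIP_of_gRIPWith hΦ).norm_map_blockProj_le_sum (by omega) _ x).trans
      (mul_le_mul_of_nonneg_right sqrt_one_add_tenth_le hleak)
  have hres : ‖WithLp.toLp 2 y - matMap Φ head‖ ≤ 1.05 * leak + ε := by
    have heq : WithLp.toLp 2 y - matMap Φ head =
        matMap Φ tail - (matMap Φ x₂ - WithLp.toLp 2 y) := by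
      rw [hsplit, map_add]
      abel
    rw [heq]
    exact (norm_sub_le _ _).trans (add_le_add hftail hx)
  have hhead : ‖head - xh₂‖ ≤ 1 / 2 ^ n * ‖head‖ + 15.1 * ‖WithLp.toLp 2 y - matMap Φ head‖ :=
    h.l2norm_sub_le_of_groupSparse hΦ
      (groupSparse_of_mem_blockSpan hA (blockProj_mem_blockSpan A x₂))
  have hdecay : 1 / 2 ^ n * ‖head‖ ≤ 1 / 2 ^ n * ‖x₂‖ := by
    gcongr
    exact hP.norm_blockProj_le A x₂
  have herror : ‖xh₂ - x₂‖ ≤ ‖head - xh₂‖ + ‖tail‖ := by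
    rw [norm_sub_rev, hsplit, add_sub_right_comm]
    exact norm_add_le _ _
  have hslack : 0 ≤ 20 * (1 / √S) * leak := by positivity
  have hε : 0 ≤ ε := (l2norm_nonneg _).trans hx
  change ‖xh₂ - x₂‖ ≤ _ + _ + 1 / 2 ^ n * ‖x₂‖
  linarith

end Recovery

end Groups

/-! ### Discrete Fourier kernels -/

section OrthogonalKernel

variable {κ ι κ' ι' : Type*} [DecidableEq ι] [DecidableEq ι'] {t : Finset κ} {s : Finset ι}
  {e : κ → ι → ℂ} {t' : Finset κ'} {s' : Finset ι'} {e' : κ' → ι' → ℂ} {N N' : ℕ}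

/-- The columns `e · i`, `i ∈ s`, of a kernel are orthogonal on `t` with squared norm `N`, as those
of a discrete Fourier transform. -/
def OrthogonalKernel (t : Finset κ) (s : Finset ι) (e : κ → ι → ℂ) (N : ℕ) : Prop :=
  ∀ i ∈ s, ∀ j ∈ s, ∑ l ∈ t, star (e l i) * e l j = if i = j then (N : ℂ) else 0

lemma OrthogonalKernel.prod (h : OrthogonalKernel t s e N) (h' : OrthogonalKernel t' s' e' N') :
    OrthogonalKernel (t ×ˢ t') (s ×ˢ s') (fun p q => e p.1 q.1 * e' p.2 q.2) (N * N') := by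
  intro q hq q' hq'
  obtain ⟨hq, hr⟩ := mem_product.1 hq
  obtain ⟨hq', hr'⟩ := mem_product.1 hq'
  calc ∑ p ∈ t ×ˢ t', star (e p.1 q.1 * e' p.2 q.2) * (e p.1 q'.1 * e' p.2 q'.2)
      = (∑ l ∈ t, star (e l q.1) * e l q'.1) * ∑ l ∈ t', star (e' l q.2) * e' l q'.2 := by
        rw [sum_mul_sum, sum_product]
        refine sum_congr rfl fun _ _ => sum_congr rfl fun _ _ => ?_
        rw [star_mul']
        ring
    _ = if q = q' then ((N * N' : ℕ) : ℂ) else 0 := by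
        rw [h _ hq _ hq', h' _ hr _ hr', Nat.cast_mul]
        split_ifs <;> simp_all [Prod.ext_iff]

lemma OrthogonalKernel.inversion (h : OrthogonalKernel t s e N) (x : ι → ℂ) {i : ι} (hi : i ∈ s) :
    ∑ l ∈ t, star (e l i) * ∑ j ∈ s, e l j * x j = N * x i :=
  calc ∑ l ∈ t, star (e l i) * ∑ j ∈ s, e l j * x j
      = ∑ j ∈ s, (∑ l ∈ t, star (e l i) * e l j) * x j := by
        simp only [mul_sum, sum_mul, mul_assoc]
        rw [sum_comm]
    _ = ∑ j ∈ s, (if i = j then (N : ℂ) else 0) * x j :=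
        sum_congr rfl fun j hj => by rw [h i hi j hj]
    _ = N * x i := by simp [hi]

lemma OrthogonalKernel.parseval (h : OrthogonalKernel t s e N) (x : ι → ℂ) :
    ∑ l ∈ t, ‖∑ i ∈ s, e l i * x i‖ ^ 2 = N * ∑ i ∈ s, ‖x i‖ ^ 2 := by
  have hcomplex : ∑ l ∈ t, star (∑ i ∈ s, e l i * x i) * ∑ i ∈ s, e l i * x i =
      N * ∑ i ∈ s, star (x i) * x i := by
    calc ∑ l ∈ t, star (∑ i ∈ s, e l i * x i) * ∑ i ∈ s, e l i * x i
        = ∑ i ∈ s, star (x i) * ∑ l ∈ t, star (e l i) * ∑ j ∈ s, e l j * x j := by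
          simp only [star_sum, star_mul, sum_mul _ (fun _ => _ * _), mul_sum s]
          rw [sum_comm]
          simp only [mul_sum, mul_assoc]
      _ = ∑ i ∈ s, star (x i) * (N * x i) :=
          sum_congr rfl fun i hi => by rw [h.inversion x hi]
      _ = N * ∑ i ∈ s, star (x i) * x i := by
          simp only [mul_sum, mul_left_comm]
  have hsq (z : ℂ) : star z * z = ((‖z‖ ^ 2 : ℝ) : ℂ) := by
    rw [Complex.star_def, Complex.conj_mul', Complex.ofReal_pow]
  simp only [hsq] at hcomplex
  exact_mod_cast hcomplex

variable {n : ℕ} [NeZero n] {c : κ → ZMod n} {d : ι → ZMod n}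

omit [DecidableEq ι] in
lemma sum_stdAddChar_mul (hc : Set.InjOn c t) (ht : #t = n) (a : ZMod n) :
    ∑ l ∈ t, ZMod.stdAddChar (c l * a) = if a = 0 then (n : ℂ) else 0 := by
  classical
  have himage : t.image c = univ :=
    eq_univ_of_card _ (by rw [card_image_of_injOn hc, ht, ZMod.card])
  rw [← sum_image (f := fun z : ZMod n => ZMod.stdAddChar (z * a)) hc, himage,
    AddChar.sum_mulShift a (ZMod.isPrimitive_stdAddChar n), ZMod.card,
    Nat.cast_ite, Nat.cast_zero]

lemma orthogonalKernel_stdAddChar (hc : Set.InjOn c t) (ht : #t = n) (hd : Set.InjOn d s) :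
    OrthogonalKernel t s (fun l i => ZMod.stdAddChar (c l * d i)) n := by
  intro i hi j hj
  have hterm (l : κ) : star (ZMod.stdAddChar (c l * d i) : ℂ) * ZMod.stdAddChar (c l * d j) =
      ZMod.stdAddChar (c l * (d j - d i)) := by
    rw [Complex.star_def, ← AddChar.map_neg_eq_conj, ← AddChar.map_add_eq_mul]
    congr 1
    ring
  simp only [hterm, sum_stdAddChar_mul hc ht, sub_eq_zero, hd.eq_iff hj hi, eq_comm]

end OrthogonalKernel

/-- The kernel `e^{-2πj(k m/K - l i/L)}` of the channel expansion, at the time-frequency position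
`(l, k)` and the Doppler-delay pair `(i, m)`. -/
def dftKernel (L K : ℕ) [NeZero L] [NeZero K] (p : ℕ × ℕ) (q : ℤ × ℕ) : ℂ :=
  ZMod.stdAddChar (p.1 * q.1 : ZMod L) * ZMod.stdAddChar (-p.2 * q.2 : ZMod K)

section DFTKernel

variable {L K J D : ℕ} [NeZero L] [NeZero K] [NeZero J] [NeZero D]

lemma exp_eq_dftKernel (l k m : ℕ) (i : ℤ) :
    Complex.exp (-2 * Real.pi * Complex.I * ((k : ℂ) * m / K - (l : ℂ) * i / L)) =
      dftKernel L K (l, k) (i, m) := by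
  have hL := ZMod.stdAddChar_coe (N := L) (l * i)
  have hK := ZMod.stdAddChar_coe (N := K) (-k * m)
  push_cast at hL hK
  rw [dftKernel, hL, hK, ← Complex.exp_add]
  congr 1
  ring

lemma star_dftKernel (p : ℕ × ℕ) (q : ℤ × ℕ) : star (dftKernel L K p q) =
    ZMod.stdAddChar (-q.1 * p.1 : ZMod L) * ZMod.stdAddChar (q.2 * p.2 : ZMod K) := by
  rw [dftKernel, star_mul', Complex.star_def, ← AddChar.map_neg_eq_conj,
    ← AddChar.map_neg_eq_conj]
  congr 2 <;> ring

lemma exp_eq_star_dftKernel (lam kap m : ℕ) (i : ℤ) :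
    Complex.exp (-2 * Real.pi * Complex.I * ((i : ℂ) * lam / J - (m : ℂ) * kap / D)) =
      star (dftKernel J D (lam, kap) (i, m)) := by
  rw [← exp_eq_dftKernel, Complex.star_def, ← Complex.exp_conj]
  congr 1
  simp only [map_mul, map_sub, map_div₀, map_neg, map_ofNat, Complex.conj_ofReal, Complex.conj_I,
    map_intCast, map_natCast]
  ring

lemma stdAddChar_mul_div_mul (h : J ∣ L) (a b : ℤ) :
    ZMod.stdAddChar (a * (L / J : ℕ) * b : ZMod L) = ZMod.stdAddChar (a * b : ZMod J) := by
  have hL := ZMod.stdAddChar_coe (N := L) (a * (L / J : ℕ) * b)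
  have hJ := ZMod.stdAddChar_coe (N := J) (a * b)
  have hL0 : (L : ℂ) ≠ 0 := NeZero.ne _
  have hJ0 : (J : ℂ) ≠ 0 := NeZero.ne _
  simp only [Int.cast_mul, Int.cast_natCast] at hL hJ
  rw [hL, hJ, Nat.cast_div h hJ0]
  congr 1
  field_simp

lemma dftKernel_grid (hJ : J ∣ L) (hD : D ∣ K) (lam kap : ℕ) (q : ℤ × ℕ) :
    dftKernel L K (lam * (L / J), kap * (K / D)) q = dftKernel J D (lam, kap) q := by
  have hL := stdAddChar_mul_div_mul hJ lam q.1
  have hK := stdAddChar_mul_div_mul hD (-kap) q.2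
  push_cast at hL hK
  rw [dftKernel, dftKernel, ← hL, ← hK]
  push_cast
  simp only [neg_mul]

end DFTKernel


lemma injOn_natCast_range (n : ℕ) : Set.InjOn (Nat.cast : ℕ → ZMod n) (range n) := by
  rw [coe_range]
  exact CharP.natCast_injOn_Iio (ZMod n) n

lemma injective_natCast_fin (n : ℕ) : Function.Injective fun i : Fin n => ((i : ℕ) : ZMod n) :=
  fun i j h => Fin.ext (injOn_natCast_range n (by simp) (by simp) h)

namespace MIMOSystem

lemma dopplerRange_mono {m n : ℕ} (h : m ≤ n) : dopplerRange m ⊆ dopplerRange n :=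
  Ico_subset_Ico (by omega) (by omega)

lemma card_dopplerRange {n : ℕ} (hn : Even n) : #(dopplerRange n) = n := by
  obtain ⟨m, rfl⟩ := hn
  rw [dopplerRange, Int.card_Ico]
  omega

lemma injOn_intCast_dopplerRange (n : ℕ) :
    Set.InjOn (Int.cast : ℤ → ZMod n) (dopplerRange n) := by
  intro i hi j hj h
  rw [dopplerRange, coe_Ico, Set.mem_Ico] at hi hj
  have hdvd : (n : ℤ) ∣ j - i := (ZMod.intCast_eq_intCast_iff_dvd_sub i j n).1 h
  have hlt : |j - i| < n := by rw [abs_lt]; omega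
  linarith [Int.eq_zero_of_abs_lt_dvd hdvd hlt]

section Kernels

variable {L K J D : ℕ} [NeZero L] [NeZero K] [NeZero J] [NeZero D]

omit [NeZero J] [NeZero D] in
lemma orthogonalKernel_dftKernel (hJ : J ≤ L) (hD : D ≤ K) :
    OrthogonalKernel (range L ×ˢ range K) (dopplerRange J ×ˢ range D) (dftKernel L K) (L * K) := by
  have htime := orthogonalKernel_stdAddChar (n := L) (injOn_natCast_range L) (card_range L)
    ((injOn_intCast_dopplerRange L).mono (coe_subset.2 (dopplerRange_mono hJ)))
  have hfreq := orthogonalKernel_stdAddChar (n := K) (c := fun k : ℕ => -(k : ZMod K))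
    (neg_injective.comp_injOn (injOn_natCast_range K)) (card_range K)
    ((injOn_natCast_range K).mono (coe_subset.2 (range_mono hD)))
  exact (htime.prod hfreq :)

lemma orthogonalKernel_dftKernel_fin :
    OrthogonalKernel univ (dopplerRange J ×ˢ range D)
      (fun μ : Fin J × Fin D => dftKernel J D (μ.1, μ.2)) (J * D) := by
  have htime := orthogonalKernel_stdAddChar (n := J) (injective_natCast_fin J).injOn
    (card_fin J) (injOn_intCast_dopplerRange J)
  have hfreq := orthogonalKernel_stdAddChar (n := D) (c := fun k : Fin D => -(k : ZMod D))
    (neg_injective.comp (injective_natCast_fin D)).injOn (card_fin D) (injOn_natCast_range D)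
  exact (htime.prod hfreq :)

lemma orthogonalKernel_star_dftKernel (hJ : Even J) :
    OrthogonalKernel (dopplerRange J ×ˢ range D) univ
      (fun q (μ : Fin J × Fin D) => star (dftKernel J D (μ.1, μ.2) q)) (J * D) := by
  have htime := orthogonalKernel_stdAddChar (n := J) (c := fun i : ℤ => -(i : ZMod J))
    (neg_injective.comp_injOn (injOn_intCast_dopplerRange J)) (card_dopplerRange hJ)
    (s := univ) (injective_natCast_fin J).injOn
  have hfreq := orthogonalKernel_stdAddChar (n := D) (injOn_natCast_range D) (card_range D)
    (s := univ) (injective_natCast_fin D).injOn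
  simp only [star_dftKernel]
  exact (htime.prod hfreq :)

end Kernels

variable (sys : MIMOSystem)

lemma J_pos : 0 < sys.J := Nat.pos_of_dvd_of_pos sys.J_dvd_L sys.L_pos

lemma D_pos : 0 < sys.D := Nat.pos_of_dvd_of_pos sys.D_dvd_K sys.K_pos

instance : NeZero sys.L := ⟨sys.L_pos.ne'⟩

instance : NeZero sys.K := ⟨sys.K_pos.ne'⟩

instance : NeZero sys.J := ⟨sys.J_pos.ne'⟩

instance : NeZero sys.D := ⟨sys.D_pos.ne'⟩

variable {sys} {F F' : ℕ → ℤ → sys.Mat}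

lemma channel_sub (F F' : ℕ → ℤ → sys.Mat) (l k : ℕ) :
    sys.channel (F - F') l k = sys.channel F l k - sys.channel F' l k := by
  simp only [channel, Pi.sub_apply, smul_sub, sum_sub_distrib]

lemma SupportedInRegion.sub (hF : sys.SupportedInRegion F) (hF' : sys.SupportedInRegion F') :
    sys.SupportedInRegion (F - F') := by
  intro m hm i hi h
  by_contra hout
  have hzero := not_imp_comm.1 (hF m hm i hi) hout
  have hzero' := not_imp_comm.1 (hF' m hm i hi) hout
  exact h (by rw [Pi.sub_apply, Pi.sub_apply, hzero, hzero', sub_zero])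

lemma SupportedInRegion.channel_apply (hF : sys.SupportedInRegion F) (l k : ℕ)
    (r : Fin sys.NR) (s : Fin sys.NT) :
    sys.channel F l k r s = ∑ q ∈ dopplerRange sys.J ×ˢ range sys.D,
      dftKernel sys.L sys.K (l, k) q * F q.2 q.1 r s := by
  have hsubset : dopplerRange sys.J ×ˢ range sys.D ⊆ dopplerRange sys.L ×ˢ range sys.K :=
    product_subset_product (dopplerRange_mono (Nat.le_of_dvd sys.L_pos sys.J_dvd_L))
      (range_mono (Nat.le_of_dvd sys.K_pos sys.D_dvd_K))
  rw [sum_subset hsubset]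
  · simp only [channel, Matrix.sum_apply, Matrix.smul_apply, smul_eq_mul, exp_eq_dftKernel,
      sum_product_right]
  · intro q hq hout
    rw [mem_product, mem_range] at hq hout
    have hzero : F q.2 q.1 = 0 := by
      by_contra h
      exact hout (hF q.2 hq.2 q.1 hq.1 h).symm
    rw [hzero, Matrix.zero_apply, mul_zero]

lemma SupportedInRegion.channel_grid_apply (hF : sys.SupportedInRegion F)
    (μ : Fin sys.J × Fin sys.D) (r : Fin sys.NR) (s : Fin sys.NT) :
    sys.channel F (sys.gridTime μ) (sys.gridFreq μ) r s =
      ∑ q ∈ dopplerRange sys.J ×ˢ range sys.D,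
        dftKernel sys.J sys.D (μ.1, μ.2) q * F q.2 q.1 r s := by
  simp only [hF.channel_apply, gridTime, gridFreq, dftKernel_grid sys.J_dvd_L sys.D_dvd_K]

lemma SupportedInRegion.sum_norm_sq_channel (hF : sys.SupportedInRegion F) (r : Fin sys.NR)
    (s : Fin sys.NT) :
    ∑ l ∈ range sys.L, ∑ k ∈ range sys.K, ‖sys.channel F l k r s‖ ^ 2 =
      (sys.K * sys.L : ℝ) / (sys.J * sys.D) *
        ∑ μ, ‖sys.channel F (sys.gridTime μ) (sys.gridFreq μ) r s‖ ^ 2 := by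
  have hfull := (orthogonalKernel_dftKernel (Nat.le_of_dvd sys.L_pos sys.J_dvd_L)
    (Nat.le_of_dvd sys.K_pos sys.D_dvd_K)).parseval fun q => F q.2 q.1 r s
  have hgrid := (orthogonalKernel_dftKernel_fin (J := sys.J) (D := sys.D)).parseval
    fun q => F q.2 q.1 r s
  have hJ : (sys.J : ℝ) ≠ 0 := NeZero.ne _
  have hD : (sys.D : ℝ) ≠ 0 := NeZero.ne _
  simp only [← hF.channel_apply, ← hF.channel_grid_apply, sum_product] at hfull hgrid
  rw [hfull, hgrid]
  push_cast
  field_simp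

lemma supportedInRegion_FHat (xh : sys.DD × sys.Chan → ℂ) :
    sys.SupportedInRegion (sys.FHat xh) := fun _ _ _ _ h =>
  by_contra fun hout => h (if_neg hout)

lemma FHat_apply (xh : sys.DD × sys.Chan → ℂ) {q : ℤ × ℕ}
    (hq : q ∈ dopplerRange sys.J ×ˢ range sys.D) (r : Fin sys.NR) (s : Fin sys.NT) :
    sys.FHat xh q.2 q.1 r s = 1 / ((sys.J : ℂ) * sys.D) *
      ∑ μ : Fin sys.J × Fin sys.D,
        star (dftKernel sys.J sys.D (μ.1, μ.2) q) * sys.HSubHat xh μ r s := by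
  rw [mem_product, mem_range, and_comm] at hq
  simp only [FHat, if_pos hq, exp_eq_star_dftKernel, Matrix.smul_apply, Matrix.sum_apply,
    smul_eq_mul, Fintype.sum_prod_type]

lemma channel_FHat_grid (xh : sys.DD × sys.Chan → ℂ) (μ : Fin sys.J × Fin sys.D) :
    sys.channel (sys.FHat xh) (sys.gridTime μ) (sys.gridFreq μ) = sys.HSubHat xh μ := by
  ext r s
  have hJ : (sys.J : ℂ) ≠ 0 := NeZero.ne _
  have hD : (sys.D : ℂ) ≠ 0 := NeZero.ne _
  have hinv := (orthogonalKernel_star_dftKernel (D := sys.D) sys.J_even).inversion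
    (fun ν => sys.HSubHat xh ν r s) (mem_univ μ)
  simp only [star_star, Nat.cast_mul] at hinv
  calc sys.channel (sys.FHat xh) (sys.gridTime μ) (sys.gridFreq μ) r s
      = ∑ q ∈ dopplerRange sys.J ×ˢ range sys.D, dftKernel sys.J sys.D (μ.1, μ.2) q *
          (1 / ((sys.J : ℂ) * sys.D) * ∑ ν : Fin sys.J × Fin sys.D,
            star (dftKernel sys.J sys.D (ν.1, ν.2) q) * sys.HSubHat xh ν r s) := by
        rw [(supportedInRegion_FHat xh).channel_grid_apply]
        exact sum_congr rfl fun q hq => by rw [FHat_apply xh hq]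
    _ = sys.HSubHat xh μ r s := by
        simp only [mul_left_comm _ (1 / ((sys.J : ℂ) * sys.D))]
        rw [← mul_sum, hinv]
        field_simp

end MIMOSystem

/-! ### Frobenius norms and the pilot matrix -/

section SpecNorm

variable {n : ℕ} (M : Matrix (Fin n) (Fin n) ℂ)

lemma specNorm_nonneg : 0 ≤ specNorm M := norm_nonneg _

lemma l2norm_mulVec_le (v : Fin n → ℂ) : l2norm (M *ᵥ v) ≤ specNorm M * l2norm v :=
  (Matrix.toEuclideanCLM (𝕜 := ℂ) M).le_opNorm (WithLp.toLp 2 v)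

lemma specNorm_conjTranspose : specNorm Mᴴ = specNorm M := by
  rw [specNorm, ← Matrix.star_eq_conjTranspose, map_star, ContinuousLinearMap.star_eq_adjoint,
    LinearIsometryEquiv.norm_map, specNorm]

lemma l2norm_star {ι : Type*} [Fintype ι] (v : ι → ℂ) : l2norm (star v) = l2norm v := by
  refine (pow_left_inj₀ (l2norm_nonneg _) (l2norm_nonneg _) two_ne_zero).1 ?_
  simp only [l2norm_sq, Pi.star_apply, norm_star]

lemma l2norm_vecMul_le (v : Fin n → ℂ) : l2norm (v ᵥ* M) ≤ specNorm M * l2norm v := by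
  have h := l2norm_mulVec_le Mᴴ (star v)
  rwa [Matrix.mulVec_conjTranspose, l2norm_star, star_star, specNorm_conjTranspose,
    l2norm_star] at h

lemma sum_norm_sq_mul_le {m : Type*} [Fintype m] (X : Matrix m (Fin n) ℂ) :
    ∑ θ : m × Fin n, ‖(X * M) θ.1 θ.2‖ ^ 2 ≤
      specNorm M ^ 2 * ∑ θ : m × Fin n, ‖X θ.1 θ.2‖ ^ 2 := by
  rw [Fintype.sum_prod_type, Fintype.sum_prod_type, mul_sum]
  refine sum_le_sum fun r _ => ?_
  have hrow := pow_le_pow_left₀ (l2norm_nonneg _) (l2norm_vecMul_le M (X r)) 2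
  rwa [mul_pow, l2norm_sq, l2norm_sq] at hrow

end SpecNorm

lemma l2norm_sq_subvec_prod {ι o β : Type*} [Fintype ι] [Fintype o] [DecidableEq β] (g : ι → β)
    (x : ι × o → ℂ) (b : β) :
    l2norm (subvec (fun jθ => g jθ.1) x b) ^ 2 =
      ∑ θ, l2norm (subvec g (fun j => x (j, θ)) b) ^ 2 := by
  simp only [l2norm_sq, subvec]
  rw [← Fintype.sum_prod_type_right',
    ← Equiv.prodSubtypeFstEquivSubtypeProd (p := fun j => g j = b).sum_comp]
  rfl

namespace MIMOSystem

variable (sys : MIMOSystem)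

/-! ### The measured coefficients -/

/-- The factor `√(JD/Q)` that normalizes the measurement matrices. -/
def scale : ℝ := √((sys.J * sys.D : ℝ) / sys.Q)

lemma scale_pos : 0 < sys.scale := by
  have hQ : (0 : ℝ) < sys.Q := Nat.cast_pos.2 sys.Q_pos
  have hJ : (0 : ℝ) < sys.J := Nat.cast_pos.2 sys.J_pos
  have hD : (0 : ℝ) < sys.D := Nat.cast_pos.2 sys.D_pos
  exact Real.sqrt_pos.2 (by positivity)

lemma sqrt_div_mul_scale :
    √((sys.K * sys.L : ℝ) / (sys.J * sys.D)) * sys.scale = √((sys.K * sys.L : ℝ) / sys.Q) := by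
  have hJ : (sys.J : ℝ) ≠ 0 := NeZero.ne _
  have hD : (sys.D : ℝ) ≠ 0 := NeZero.ne _
  rw [scale, ← Real.sqrt_mul (by positivity)]
  congr 1
  field_simp

/-- The vector `x` measured by the stacked matrix `Φ`: up to the factor `√(JD/Q)`, its entries are
those of the matrices `G̃_{m,i} = G_{m,i} P`. -/
def measured (F : ℕ → ℤ → sys.Mat) : sys.DD × sys.Chan → ℂ := fun cθ =>
  (sys.scale : ℂ)⁻¹ * (sys.coeff F cθ.1 * sys.pilotMatrix) cθ.2.1 cθ.2.2

variable {sys}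

lemma sum_basis_smul_coeff (F : ℕ → ℤ → sys.Mat) (μ : Fin sys.J × Fin sys.D) :
    ∑ c, sys.u c μ • sys.coeff F c = sys.channel F (sys.gridTime μ) (sys.gridFreq μ) := by
  ext r s
  have h := congrArg (fun v : EuclideanSpace ℂ (Fin sys.J × Fin sys.D) => v μ)
    (sys.u.sum_repr
      (WithLp.toLp 2 fun μ => sys.channel F (sys.gridTime μ) (sys.gridFreq μ) r s))
  simp only [WithLp.ofLp_sum, Finset.sum_apply, PiLp.smul_apply, smul_eq_mul] at h
  rw [← h, Matrix.sum_apply]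
  exact sum_congr rfl fun c _ => mul_comm _ _

lemma sum_norm_sq_basis (a : sys.DD → ℂ) :
    ∑ μ, ‖∑ c, sys.u c μ * a c‖ ^ 2 = ∑ c, ‖a c‖ ^ 2 := by
  have h : ‖∑ c, a c • sys.u c‖ ^ 2 = ‖(WithLp.toLp 2 a : EuclideanSpace ℂ _)‖ ^ 2 := by
    rw [← LinearIsometryEquiv.norm_map sys.u.repr.symm, ← sys.u.sum_repr_symm]
  simp only [EuclideanSpace.norm_sq_eq, WithLp.ofLp_sum, Finset.sum_apply, PiLp.smul_apply,
    smul_eq_mul] at h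
  simpa only [mul_comm] using h

lemma PhiStack_mulVec_measured (F : ℕ → ℤ → sys.Mat) {a : ℕ → ℕ → Fin sys.NT → ℂ}
    (ha : sys.TransmitsPilots a) (z : ℕ → ℕ → Fin sys.NR → ℂ) :
    sys.PhiStack *ᵥ sys.measured F - sys.stackPilots (sys.received F a z) =
      -sys.stackPilots z := by
  ext ⟨q, r, s⟩
  let μ := sys.pos s q
  have hscale : (sys.scale : ℂ) ≠ 0 := Complex.ofReal_ne_zero.2 sys.scale_pos.ne'
  have hPhi : (sys.PhiStack *ᵥ sys.measured F) (q, r, s) =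
      ∑ c, sys.u c μ * (sys.coeff F c * sys.pilotMatrix) r s := by
    rw [PhiStack, blockDiagonal_mulVec_apply, Matrix.mulVec, dotProduct]
    refine sum_congr rfl fun c _ => ?_
    rw [Phi, Matrix.of_apply, measured, ← scale, mul_right_comm, mul_inv_cancel_left₀ hscale,
      mul_comm]
  have hchannel : ∑ c, sys.u c μ * (sys.coeff F c * sys.pilotMatrix) r s =
      (sys.channel F (sys.gridTime μ) (sys.gridFreq μ) * sys.pilotMatrix) r s := by
    simp only [← sum_basis_smul_coeff, Matrix.sum_mul, Matrix.sum_apply, Matrix.smul_mul,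
      Matrix.smul_apply, smul_eq_mul]
  have hreceived : sys.stackPilots (sys.received F a z) (q, r, s) =
      (sys.channel F (sys.gridTime μ) (sys.gridFreq μ) * sys.pilotMatrix) r s +
        sys.stackPilots z (q, r, s) := by
    rw [stackPilots, atPilots, received, ha s q]
    rfl
  rw [Pi.sub_apply, hPhi, hchannel, hreceived, Pi.neg_apply, sub_add_cancel_left]

lemma l2norm_stackPilots (z : ℕ → ℕ → Fin sys.NR → ℂ) :
    l2norm (sys.stackPilots z) = √(∑ θ, l2norm (sys.atPilots z θ) ^ 2) :=
  (Real.sqrt_eq_iff_eq_sq (by positivity) (l2norm_nonneg _)).2 (l2norm_sq_prod _).symm |>.symm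

lemma l2norm_mulVec_measured_sub_le (F : ℕ → ℤ → sys.Mat) {a : ℕ → ℕ → Fin sys.NT → ℂ}
    (ha : sys.TransmitsPilots a) {z : ℕ → ℕ → Fin sys.NR → ℂ} {ε : ℝ}
    (hz : √(∑ θ : sys.Chan, l2norm (sys.atPilots z θ) ^ 2) ≤ ε) :
    l2norm (sys.PhiStack *ᵥ sys.measured F - sys.stackPilots (sys.received F a z)) ≤ ε := by
  rwa [PhiStack_mulVec_measured F ha z, l2norm, WithLp.toLp_neg, norm_neg, ← l2norm,
    l2norm_stackPilots]

lemma sum_norm_sq_measured_le (F : ℕ → ℤ → sys.Mat) (c : sys.DD) :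
    ∑ θ : sys.Chan, ‖sys.measured F (c, θ)‖ ^ 2 ≤
      (sys.scale⁻¹ * specNorm sys.pilotMatrix) ^ 2 *
        ∑ θ : sys.Chan, ‖sys.coeff F c θ.1 θ.2‖ ^ 2 := by
  simp only [measured, norm_mul, norm_inv, Complex.norm_real, mul_pow, ← mul_sum,
    Real.norm_of_nonneg sys.scale_pos.le, mul_assoc]
  gcongr
  exact sum_norm_sq_mul_le _ _

lemma l2norm_measured_le (F : ℕ → ℤ → sys.Mat) :
    l2norm (sys.measured F) ≤ sys.scale⁻¹ * specNorm sys.pilotMatrix *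
      √(∑ θ : sys.Chan, ∑ c : sys.DD, ‖sys.coeff F c θ.1 θ.2‖ ^ 2) := by
  have hnonneg : 0 ≤ sys.scale⁻¹ * specNorm sys.pilotMatrix :=
    mul_nonneg (inv_nonneg.2 sys.scale_pos.le) (specNorm_nonneg _)
  refine le_of_sq_le_sq ?_ (by positivity)
  rw [mul_pow, Real.sq_sqrt (by positivity), sum_comm, l2norm_sq, Fintype.sum_prod_type, mul_sum]
  exact sum_le_sum fun c _ => sum_norm_sq_measured_le F c

section Leakage

variable {β : Type*} [DecidableEq β]

lemma l2norm_subvec_measured_le (F : ℕ → ℤ → sys.Mat) (g : sys.DD → β) (b : β) :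
    l2norm (subvec (sys.stackPartition g) (sys.measured F) b) ≤
      sys.scale⁻¹ * specNorm sys.pilotMatrix *
        √(∑ θ : sys.Chan, l2norm (subvec g (fun c => sys.coeff F c θ.1 θ.2) b) ^ 2) := by
  have hnonneg : 0 ≤ sys.scale⁻¹ * specNorm sys.pilotMatrix :=
    mul_nonneg (inv_nonneg.2 sys.scale_pos.le) (specNorm_nonneg _)
  refine le_of_sq_le_sq ?_ (by positivity)
  rw [mul_pow, Real.sq_sqrt (by positivity)]
  refine (l2norm_sq_subvec_prod g _ b).trans_le ?_
  simp only [l2norm_sq, subvec]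
  conv_rhs => rw [sum_comm, mul_sum]
  rw [sum_comm]
  exact sum_le_sum fun j _ => sum_norm_sq_measured_le F j

lemma sum_l2norm_subvec_measured_le [Fintype β] (F : ℕ → ℤ → sys.Mat) (g : sys.DD → β)
    (A : Finset β) :
    ∑ b ∈ Aᶜ, l2norm (subvec (sys.stackPartition g) (sys.measured F) b) ≤
      sys.scale⁻¹ * specNorm sys.pilotMatrix * sys.leakage g A F := by
  rw [leakage, mul_sum]
  exact sum_le_sum fun b _ => l2norm_subvec_measured_le F g b

end Leakage

/-! ### From the compressed sensing error to the channel estimation error -/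

lemma GHat_eq (xh : sys.DD × sys.Chan → ℂ) (c : sys.DD) :
    sys.GHat xh c =
      (sys.scale : ℂ) • (Matrix.of fun r s => xh (c, (r, s))) * sys.pilotMatrix⁻¹ := by
  ext r s
  rw [GHat, Matrix.of_apply, ← Matrix.transpose_nonsing_inv, Matrix.mulVec_transpose]
  rfl

lemma GHat_sub (xh x : sys.DD × sys.Chan → ℂ) (c : sys.DD) :
    sys.GHat (xh - x) c = sys.GHat xh c - sys.GHat x c := by
  rw [GHat_eq, GHat_eq, GHat_eq, ← Matrix.sub_mul, ← smul_sub]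
  rfl

lemma isUnit_det_pilotMatrix : IsUnit sys.pilotMatrix.det := by
  rw [← Matrix.det_transpose, ← Matrix.isUnit_iff_isUnit_det]
  exact Matrix.linearIndependent_rows_iff_isUnit.1 sys.p_indep

lemma GHat_measured (F : ℕ → ℤ → sys.Mat) (c : sys.DD) :
    sys.GHat (sys.measured F) c = sys.coeff F c := by
  have hscale : (sys.scale : ℂ) ≠ 0 := Complex.ofReal_ne_zero.2 sys.scale_pos.ne'
  have hpilot : (sys.scale : ℂ) • (Matrix.of fun r s => sys.measured F (c, (r, s))) =
      sys.coeff F c * sys.pilotMatrix := by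
    ext r s
    simp only [measured, Matrix.smul_apply, Matrix.of_apply, smul_eq_mul,
      mul_inv_cancel_left₀ hscale]
  rw [GHat_eq, hpilot, Matrix.mul_nonsing_inv_cancel_right _ _ isUnit_det_pilotMatrix]

lemma HSubHat_sub_channel (F : ℕ → ℤ → sys.Mat) (xh : sys.DD × sys.Chan → ℂ)
    (μ : Fin sys.J × Fin sys.D) :
    sys.HSubHat xh μ - sys.channel F (sys.gridTime μ) (sys.gridFreq μ) =
      sys.HSubHat (xh - sys.measured F) μ := by
  simp only [HSubHat, GHat_sub, GHat_measured, smul_sub, sum_sub_distrib, sum_basis_smul_coeff]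

lemma sum_norm_sq_HSubHat_le (x : sys.DD × sys.Chan → ℂ) :
    ∑ θ : sys.Chan, ∑ μ, ‖sys.HSubHat x μ θ.1 θ.2‖ ^ 2 ≤
      (specNorm sys.pilotMatrix⁻¹ * sys.scale * l2norm x) ^ 2 := by
  have hGHat (c : sys.DD) : ∑ θ : sys.Chan, ‖sys.GHat x c θ.1 θ.2‖ ^ 2 ≤
      (specNorm sys.pilotMatrix⁻¹ * sys.scale) ^ 2 * ∑ θ : sys.Chan, ‖x (c, θ)‖ ^ 2 := by
    rw [GHat_eq]
    refine (sum_norm_sq_mul_le _ _).trans_eq ?_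
    simp only [Matrix.smul_apply, Matrix.of_apply, smul_eq_mul, norm_mul, Complex.norm_real,
      mul_pow, Real.norm_of_nonneg sys.scale_pos.le, ← mul_sum, mul_assoc]
  simp only [HSubHat, Matrix.sum_apply, Matrix.smul_apply, smul_eq_mul, sum_norm_sq_basis]
  rw [sum_comm, mul_pow, l2norm_sq,
    Fintype.sum_prod_type fun cθ : sys.DD × sys.Chan => ‖x cθ‖ ^ 2, mul_sum]
  exact sum_le_sum fun c _ => hGHat c

lemma rmse_le {F : ℕ → ℤ → sys.Mat} (hF : sys.SupportedInRegion F)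
    (xh : sys.DD × sys.Chan → ℂ) :
    sys.rmse F xh ≤ √((sys.K * sys.L : ℝ) / sys.Q) * specNorm sys.pilotMatrix⁻¹ *
      l2norm (xh - sys.measured F) := by
  have hsupport : sys.SupportedInRegion (sys.FHat xh - F) := (supportedInRegion_FHat xh).sub hF
  have hgrid (μ : Fin sys.J × Fin sys.D) :
      sys.channel (sys.FHat xh - F) (sys.gridTime μ) (sys.gridFreq μ) =
        sys.HSubHat (xh - sys.measured F) μ := by
    rw [channel_sub, channel_FHat_grid, HSubHat_sub_channel]
  have hnonneg := mul_nonneg (mul_nonneg (specNorm_nonneg sys.pilotMatrix⁻¹) sys.scale_pos.le)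
    (l2norm_nonneg (xh - sys.measured F))
  calc sys.rmse F xh
      = √((sys.K * sys.L : ℝ) / (sys.J * sys.D) *
          ∑ θ : sys.Chan, ∑ μ, ‖sys.HSubHat (xh - sys.measured F) μ θ.1 θ.2‖ ^ 2) := by
        simp only [rmse, HHat, ← Matrix.sub_apply, ← channel_sub, hsupport.sum_norm_sq_channel,
          hgrid, mul_sum]
    _ ≤ √((sys.K * sys.L : ℝ) / (sys.J * sys.D) *
          (specNorm sys.pilotMatrix⁻¹ * sys.scale * l2norm (xh - sys.measured F)) ^ 2) := by
        gcongr
        exact sum_norm_sq_HSubHat_le _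
    _ = √((sys.K * sys.L : ℝ) / sys.Q) * specNorm sys.pilotMatrix⁻¹ *
          l2norm (xh - sys.measured F) := by
        rw [Real.sqrt_mul (by positivity), Real.sqrt_sq hnonneg, ← sqrt_div_mul_scale]
        ring

lemma rmse_le_of_l2norm_sub_le {β : Type*} [Fintype β] [DecidableEq β] {F : ℕ → ℤ → sys.Mat}
    (hF : sys.SupportedInRegion F) {xh : sys.DD × sys.Chan → ℂ} (g : sys.DD → β) (A : Finset β)
    {a b c ε : ℝ} (ha : 0 ≤ a) (hc : 0 ≤ c)
    (h : l2norm (xh - sys.measured F) ≤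
      a * (∑ b ∈ Aᶜ, l2norm (subvec (sys.stackPartition g) (sys.measured F) b)) + b * ε +
        c * l2norm (sys.measured F)) :
    sys.rmse F xh ≤ a * √((sys.K * sys.L : ℝ) / (sys.J * sys.D)) * sys.CP * sys.leakage g A F +
      b * √((sys.K * sys.L : ℝ) / sys.Q) * specNorm sys.pilotMatrix⁻¹ * ε +
      c * sys.CP * √((sys.K * sys.L : ℝ) / (sys.J * sys.D) *
        ∑ θ : sys.Chan, ∑ c : sys.DD, ‖sys.coeff F c θ.1 θ.2‖ ^ 2) := by
  have hscale := sys.scale_pos.ne'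
  have hP := specNorm_nonneg sys.pilotMatrix⁻¹
  calc sys.rmse F xh
      ≤ √((sys.K * sys.L : ℝ) / sys.Q) * specNorm sys.pilotMatrix⁻¹ *
          l2norm (xh - sys.measured F) := rmse_le hF xh
    _ ≤ √((sys.K * sys.L : ℝ) / sys.Q) * specNorm sys.pilotMatrix⁻¹ *
          (a * (sys.scale⁻¹ * specNorm sys.pilotMatrix * sys.leakage g A F) + b * ε +
            c * (sys.scale⁻¹ * specNorm sys.pilotMatrix *
              √(∑ θ : sys.Chan, ∑ c : sys.DD, ‖sys.coeff F c θ.1 θ.2‖ ^ 2))) := by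
        refine mul_le_mul_of_nonneg_left (h.trans ?_) (by positivity)
        gcongr
        · exact sum_l2norm_subvec_measured_le F g A
        · exact l2norm_measured_le F
    _ = _ := by
        rw [← sqrt_div_mul_scale, Real.sqrt_mul (by positivity), CP]
        field_simp

/-! ### The restricted isometry constant of the stacked matrix -/

section PhiStack

variable {β : Type*} [Finite β] {g : sys.DD → β} {n : ℕ} {δ : ℝ}

lemma gRIPWith_PhiStack (h : ∀ s, GRIPWith g n (sys.Phi s) δ) :
    GRIPWith (sys.stackPartition g) n sys.PhiStack δ :=
  gRIPWith_blockDiagonal fun θ : sys.Chan => h θ.2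

lemma gRIC_PhiStack_lt (hδ : 0 < δ)
    (h : ∀ s, HasGRIP g n (sys.Phi s) ∧ gRIC g n (sys.Phi s) < δ) :
    GRIPWith (sys.stackPartition g) n sys.PhiStack (gRIC (sys.stackPartition g) n sys.PhiStack) ∧
      gRIC (sys.stackPartition g) n sys.PhiStack < δ := by
  obtain ⟨δ', hδ'0, hδ', hle⟩ : ∃ δ', 0 ≤ δ' ∧ δ' < δ ∧ ∀ s, gRIC g n (sys.Phi s) ≤ δ' := by
    rcases isEmpty_or_nonempty (Fin sys.NT) with hempty | hne
    · exact ⟨0, le_rfl, hδ, fun s => hempty.elim s⟩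
    · obtain ⟨s, hs⟩ := Finite.exists_max fun s => gRIC g n (sys.Phi s)
      exact ⟨_, gRIC_nonneg _ _ _, (h s).2, hs⟩
  have hstack := gRIPWith_PhiStack fun s => (h s).1.gRIPWith_gRIC.mono (hle s)
  exact ⟨hstack.gRIPWith_gRIC hδ'0, (gRIC_le hδ'0 hstack).trans_lt hδ'⟩

end PhiStack

end MIMOSystem

lemma c0_nonneg {δ : ℝ} (h : δ < √2 - 1) : 0 ≤ c0 δ := by
  have hsqrt : √(2 : ℝ) ≤ 2 := by rw [Real.sqrt_le_left (by norm_num)]; norm_num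
  exact div_nonneg (by linarith) (sub_nonneg.2 (one_add_sqrt_two_mul_lt_one h).le)

end MGCS

end

theorem theorem1
    (sys : MGCS.MIMOSystem)
    -- the partition used by the reconstruction method, `S` and the set of `S` groups
    {B : ℕ} (g : sys.DD → Fin B) (S : ℕ) (hS : 0 < S)
    (A : Finset (Fin B)) (hA : A.card = S)
    -- the channel, the transmitted symbols and the noise
    (F : ℕ → ℤ → sys.Mat) (hF : sys.SupportedInRegion F)
    (a : ℕ → ℕ → Fin sys.NT → ℂ) (ha : sys.TransmitsPilots a)
    (z : ℕ → ℕ → Fin sys.NR → ℂ)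
    (ε : ℝ) (hε : 0 < ε)
    (hz : √(∑ θ : sys.Chan, MGCS.l2norm (sys.atPilots z θ) ^ 2) ≤ ε) :
    -- group basis pursuit denoising
    ((∀ s, MGCS.HasGRIP g (2 * S) (sys.Phi s) ∧ MGCS.gRIC g (2 * S) (sys.Phi s) < √2 - 1) →
      ∀ xh : sys.DD × sys.Chan → ℂ,
        MGCS.IsGBPDNSolution (sys.stackPartition g) sys.PhiStack
          (sys.stackPilots (sys.received F a z)) ε xh →
        sys.rmse F xh ≤
          MGCS.c0 (MGCS.gRIC (sys.stackPartition g) (2 * S) sys.PhiStack) *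
              √((sys.K * sys.L : ℝ) / (sys.J * sys.D)) * sys.CP *
              (sys.leakage g A F / √S) +
            MGCS.c1 (MGCS.gRIC (sys.stackPartition g) (2 * S) sys.PhiStack) *
              √((sys.K * sys.L : ℝ) / sys.Q) * MGCS.specNorm sys.pilotMatrix⁻¹ * ε) ∧
    -- group CoSaMP
    ((∀ s, MGCS.HasGRIP g (4 * S) (sys.Phi s) ∧ MGCS.gRIC g (4 * S) (sys.Phi s) ≤ 0.1) →
      ∀ (n : ℕ) (xh : sys.DD × sys.Chan → ℂ),
        MGCS.IsGCoSaMPIterate (sys.stackPartition g) S sys.PhiStack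
          (sys.stackPilots (sys.received F a z)) n xh →
        sys.rmse F xh ≤
          20 * √((sys.K * sys.L : ℝ) / (sys.J * sys.D)) * sys.CP *
              (1 + 1 / √S) * sys.leakage g A F +
            20 * √((sys.K * sys.L : ℝ) / sys.Q) * MGCS.specNorm sys.pilotMatrix⁻¹ * ε +
            1 / 2 ^ n * sys.CP *
              √((sys.K * sys.L : ℝ) / (sys.J * sys.D) *
                ∑ θ : sys.Chan, ∑ c : sys.DD, ‖sys.coeff F c θ.1 θ.2‖ ^ 2)) := by
  have hnoise := MGCS.MIMOSystem.l2norm_mulVec_measured_sub_le F ha hz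
  constructor
  · intro h xh hxh
    have hpos : 0 < √2 - 1 := sub_pos.2 (Real.lt_sqrt_of_sq_lt (by norm_num))
    obtain ⟨hrip, hlt⟩ := MGCS.MIMOSystem.gRIC_PhiStack_lt hpos h
    set δ := MGCS.gRIC (sys.stackPartition g) (2 * S) sys.PhiStack
    have herr := hxh.l2norm_sub_le hnoise hS (MGCS.gRIC_nonneg _ _ _) hlt hrip hA.le
    have hrmse := MGCS.MIMOSystem.rmse_le_of_l2norm_sub_le hF g A (a := MGCS.c0 δ / √S)
      (b := MGCS.c1 δ) (c := 0) (ε := ε) (div_nonneg (MGCS.c0_nonneg hlt) (Real.sqrt_nonneg _))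
      le_rfl (herr.trans_eq (by ring))
    exact hrmse.trans_eq (by ring)
  · intro h n xh hxh
    have hrip := MGCS.MIMOSystem.gRIPWith_PhiStack fun s => (h s).1.gRIPWith_gRIC.mono (h s).2
    have herr := hxh.l2norm_sub_le hS hrip hnoise hA.le
    have hrmse := MGCS.MIMOSystem.rmse_le_of_l2norm_sub_le hF g A (a := 20 * (1 + 1 / √S))
      (b := 20) (c := 1 / 2 ^ n) (ε := ε) (by positivity) (by positivity) herr
    exact hrmse.trans_eq (by ring)
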